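/- Let $K$ be a field, $S=K[x_1,\dots,x_n]$ ($n\ge 0$) with the standard grading, and let $I\subset S$ be a quadratic monomial ideal, i.e. an ideal generated by a (possibly empty) set of monomials of degree $2$ (squares $x_i^2$ are allowed). Let $c$ be the codimension (height) of $I$ and let $\mathrm{GEN}(I)$ be the set of minimal monomial generators of $I$. For $1\le i\le c$ let $$\tilde M_i=\max\{\deg\operatorname{lcm}(T): T\subseteq \mathrm{GEN}(I),\ |T|=i\},\qquad \tilde m_i=\min\{\deg\operatorname{lcm}(T): T\subseteq \mathrm{GEN}(I),\ |T|=i\}$$ be the maximal and minimal shifts of the Taylor resolution of $S/I$ in homological degree $i$; that is, the maximal and minimal $j$ with $\beta_{i,j}\ne 0$, where $\beta_{i,j}=|\{T\subseteq\mathrm{GEN}(I): |T|=i,\ \deg\operatorname{lcm}(T)=j\}|$ is the number of summands $S(-j)$ in homological degree $i$ of that resolution. Let $e(S/I)$ be the multiplicity of $S/I$: if $d=\dim S/I$ and the Hilbert series is $\sum_{k\ge0}\dim_K (S/I)_k\,\lambda^k=h(\lambda)/(1-\lambda)^d$ with $h\in\mathbb Z[\lambda]$, then $e(S/I)=h(1)$.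 Then $$e(S/I)\le \frac{1}{c!}\prod_{i=1}^{c}\tilde M_i .$$ If moreover $S/I$ is Cohen–Macaulay (there is a regular sequence on $S/I$ of $\dim S/I$ homogeneous elements of positive degree), then also $$e(S/I)\ge \frac{1}{c!}\prod_{i=1}^{c}\tilde m_i .$$ -/

import Mathlib

namespace TaylorBound

open MvPolynomial

noncomputable section

variable {σ K : Type*} [Field K]

/-- A quadratic monomial ideal: an ideal generated by (a possibly empty set of) monomials of
degree two, such as `x y` or `x ^ 2`.  Monomials are encoded by their exponent vectors. -/
def IsQuadraticMonomialIdeal (I : Ideal (MvPolynomial σ K)) : Prop :=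
  ∃ A : Set (σ →₀ ℕ), (∀ a ∈ A, a.degree = 2) ∧
    I = Ideal.span ((fun a => monomial a (1 : K)) '' A)

/-- The set `GEN(I)` of minimal monomial generators of a monomial ideal `I`: the (exponent vectors
of the) monomials in `I` that are minimal under divisibility. -/
def minGens (I : Ideal (MvPolynomial σ K)) : Set (σ →₀ ℕ) :=
  {a | Minimal (fun b => monomial b (1 : K) ∈ I) a}

/-- The standard basis of the free module in homological degree `i` of the Taylor resolution of
`S / I`: one basis element for each `i`-element set of minimal generators, i.e. for each
`(i - 1)`-dimensional face of the full simplex whose vertices are labeled by `GEN(I)`. -/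
def taylorBasis (I : Ideal (MvPolynomial σ K)) (i : ℕ) : Set (Finset (σ →₀ ℕ)) :=
  {T | (T : Set (σ →₀ ℕ)) ⊆ minGens I ∧ T.card = i}

/-- The degree of the basis element of the Taylor resolution indexed by `T`: the degree of the
least common multiple of the monomials in `T` (the supremum of their exponent vectors). -/
def taylorDegree (T : Finset (σ →₀ ℕ)) : ℕ :=
  (T.sup id).degree

/-- The graded Betti number `β_{i,j}` of the Taylor resolution: the number of summands `S(-j)` in
homological degree `i`. -/
def taylorBetti (I : Ideal (MvPolynomial σ K)) (i j : ℕ) : ℕ :=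
  {T ∈ taylorBasis I i | taylorDegree T = j}.ncard

/-- The maximal shift `max {j : β_{i,j} ≠ 0}` of the Taylor resolution in homological degree `i`. -/
def taylorMaxShift (I : Ideal (MvPolynomial σ K)) (i : ℕ) : ℕ :=
  sSup {j | taylorBetti I i j ≠ 0}

/-- The minimal shift `min {j : β_{i,j} ≠ 0}` of the Taylor resolution in homological degree `i`. -/
def taylorMinShift (I : Ideal (MvPolynomial σ K)) (i : ℕ) : ℕ :=
  sInf {j | taylorBetti I i j ≠ 0}

/-- The Hilbert function `k ↦ dim_K (S / I)_k`, where `(S / I)_k` is the image in `S / I` of the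
space of homogeneous polynomials of degree `k`. -/
def hilbertFunction (I : Ideal (MvPolynomial σ K)) (k : ℕ) : ℕ :=
  Module.finrank K ((homogeneousSubmodule σ K k).map (Ideal.Quotient.mkₐ K I).toLinearMap)

/-- The Hilbert series `∑ k, dim_K (S / I)_k λ ^ k`. -/
def hilbertSeries (I : Ideal (MvPolynomial σ K)) : PowerSeries ℤ :=
  PowerSeries.mk fun k => (hilbertFunction I k : ℤ)

/-- `e` is the multiplicity of `S / I`: the Hilbert series of `S / I` is `h(λ) / (1 - λ) ^ d` with
`d` the Krull dimension of `S / I` and `h` an integer polynomial, and `e = h(1)`. -/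
def HasMultiplicity (I : Ideal (MvPolynomial σ K)) (e : ℕ) : Prop :=
  ∃ (d : ℕ) (h : Polynomial ℤ), ringKrullDim (MvPolynomial σ K ⧸ I) = d ∧
    hilbertSeries I * (1 - PowerSeries.X) ^ d = (h : PowerSeries ℤ) ∧ h.eval 1 = (e : ℤ)

/-- The multiplicity is well defined. -/
theorem HasMultiplicity.unique {I : Ideal (MvPolynomial σ K)} {e e' : ℕ}
    (he : HasMultiplicity I e) (he' : HasMultiplicity I e') : e = e' := by
  obtain ⟨d, h, hd, hh, hv⟩ := he
  obtain ⟨d', h', hd', hh', hv'⟩ := he'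
  have hdd : d = d' := by
    have := hd.symm.trans hd'
    exact_mod_cast this
  subst hdd
  have : h = h' := Polynomial.coe_injective ℤ (hh.symm.trans hh')
  subst this
  exact_mod_cast hv.symm.trans hv'

/-- `S / I` is Cohen-Macaulay (as a graded algebra): its depth equals its dimension, i.e. there is
a regular sequence on `S / I` of homogeneous elements of positive degree whose length is the Krull
dimension of `S / I`. -/
def IsCohenMacaulayQuotient (I : Ideal (MvPolynomial σ K)) : Prop :=
  ∃ θ : List (MvPolynomial σ K), (∀ f ∈ θ, ∃ k : ℕ, 0 < k ∧ f.IsHomogeneous k) ∧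
    RingTheory.Sequence.IsRegular (MvPolynomial σ K ⧸ I) θ ∧
    ringKrullDim (MvPolynomial σ K ⧸ I) = (θ.length : ℕ)

end

end TaylorBound

/-!
Polarization turns the generators of `I` into the edges of a graph: a monomial becomes the set of
the vertices `⟨v, k⟩` with `k` less than its exponent at `v`. The degree of the least common
multiple of a set of generators is the number of vertices spanned by the corresponding edges, so the
shifts of the Taylor resolution are extremal sizes of such vertex sets. The codimension `c` of `I`
is the least size of a vertex cover (`height_monIdeal`), and the multiplicity `e` is the number of
covers of this size (`hasMultiplicity_monIdeal`): in the Hilbert series, the monomials outside of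
`I` with given exponents truncated at `2` contribute `X ^ m / (1 - X) ^ t`, where `t` is the number
of truncated exponents equal to `2`.

*Upper bound* (`card_minCovers_mul_factorial_le`). Count the pairs `v ∈ C` with `C` a smallest
cover. The smallest covers through `v` correspond to those of the graph without the edges at `v`,
whose cover number is `c - 1`, so induction applies once the vertices lying on smallest covers are
at most as many as `c` edges can span. They are spanned by `c` edges: those outside of a fixed
smallest cover can be matched into it by Hall's theorem, and each unmatched vertex of the cover has
a private edge.

*Lower bound* (`prod_le_card_minCovers_mul_factorial`). If `S / I` is Cohen-Macaulay, then the
smallest covers are connected in codimension one (`connectedInCodimOne_minCovers`) and have no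
common vertex (`exists_minCover_notMem`). Both properties pass to the connected components of the
graph, and they force a component of cover number `a` to have at least `a + 1` smallest covers.
Since a component with `a` or more edges contains `i` edges with at most `i + 1` vertices for each
`i ≤ a`, comparing factors gives `∏ m̃ᵢ ≤ c! ∏ (a + 1) ≤ c! e`.

The two consequences of the Cohen-Macaulay property are obtained after localizing at the ideal of
all variables: `HasDepth.le_coheight` (depth is bounded by the dimension of each associated prime)
gives unmixedness, and `HasDepth.le_inf_or_le_inf` is Hartshorne's connectedness theorem. Both rest
on elementary manipulations of regular sequences on cyclic modules `R / J`, the main one being that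
the depth drops by at most one modulo any nonzerodivisor (`HasDepth.sup_span`).
-/

/-! ### Smallest vertex covers and the upper bound -/

namespace TaylorBound

section Covers

variable {α : Type*} {E : Finset (Finset α)} {C : Finset α} {v : α}

/-- A set of vertices `C` is a vertex cover of the family `E` of edges if it meets every edge. -/
def IsCover (E : Finset (Finset α)) (C : Finset α) : Prop :=
  ∀ e ∈ E, ∃ x ∈ e, x ∈ C

/-- The least size of a vertex cover. -/
noncomputable def coverNumber (E : Finset (Finset α)) : ℕ :=
  sInf {k | ∃ C, IsCover E C ∧ C.card = k}

theorem coverNumber_le (h : IsCover E C) : coverNumber E ≤ C.card :=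
  Nat.sInf_le ⟨C, h, rfl⟩

variable [DecidableEq α]

open Classical in
/-- The vertex covers of least size. -/
noncomputable def minCovers (E : Finset (Finset α)) : Finset (Finset α) :=
  (E.sup id).powerset.filter fun C => IsCover E C ∧ C.card = coverNumber E

/-- The maximal number of vertices of `i` edges. -/
def maxSpan (E : Finset (Finset α)) (i : ℕ) : ℕ :=
  (E.powersetCard i).sup fun T => (T.sup id).card

theorem mem_support_of_mem {e : Finset α} (he : e ∈ E) (hv : v ∈ e) : v ∈ E.sup id :=
  Finset.mem_sup.2 ⟨e, he, hv⟩

theorem IsCover.inter_support (h : IsCover E C) : IsCover E (C ∩ E.sup id) := fun e he => by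
  obtain ⟨x, hx, hxC⟩ := h e he
  exact ⟨x, hx, Finset.mem_inter.2 ⟨hxC, mem_support_of_mem he hx⟩⟩

theorem mem_minCovers : C ∈ minCovers E ↔ IsCover E C ∧ C.card = coverNumber E := by
  classical
  simp only [minCovers, Finset.mem_filter, Finset.mem_powerset, and_iff_right_iff_imp]
  rintro ⟨h, hc⟩
  have h1 := coverNumber_le h.inter_support
  have h2 := Finset.eq_of_subset_of_card_le (Finset.inter_subset_left (s₁ := C) (s₂ := E.sup id))
    (by omega)
  rw [← h2]
  exact Finset.inter_subset_right

theorem subset_support_of_mem_minCovers (h : C ∈ minCovers E) : C ⊆ E.sup id := by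
  classical
  exact Finset.mem_powerset.1 (Finset.mem_filter.1 h).1

theorem minCovers_nonempty (hE : ∀ e ∈ E, e.Nonempty) : (minCovers E).Nonempty := by
  have hne : {k | ∃ C, IsCover E C ∧ C.card = k}.Nonempty :=
    ⟨_, E.sup id, fun e he => (hE e he).imp fun x hx => ⟨hx, mem_support_of_mem he hx⟩, rfl⟩
  obtain ⟨C, hC, hc⟩ := Nat.sInf_mem hne
  exact ⟨C, mem_minCovers.2 ⟨hC, hc⟩⟩

/-- Every vertex of a smallest vertex cover is the only vertex of the cover on some edge. -/
theorem exists_private_edge (h : C ∈ minCovers E) (hv : v ∈ C) :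
    ∃ e ∈ E, e ∩ C = {v} := by
  by_contra! hcon
  obtain ⟨hC, hc⟩ := mem_minCovers.1 h
  have : IsCover E (C.erase v) := by
    intro e he
    by_contra! hx
    refine hcon e he (Finset.eq_singleton_iff_unique_mem.2 ⟨?_, ?_⟩)
    · obtain ⟨x, hxe, hxC⟩ := hC e he
      have := hx x hxe
      rw [Finset.mem_erase, not_and'] at this
      obtain rfl := not_not.1 (this hxC)
      exact Finset.mem_inter.2 ⟨hxe, hxC⟩
    · intro x hxm
      obtain ⟨hxe, hxC⟩ := Finset.mem_inter.1 hxm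
      have := hx x hxe
      rw [Finset.mem_erase, not_and'] at this
      exact not_not.1 (this hxC)
  have h1 := coverNumber_le this
  have h2 := Finset.card_erase_lt_of_mem hv
  omega

theorem coverNumber_le_card (hE : ∀ e ∈ E, e.Nonempty) : coverNumber E ≤ E.card := by
  choose f hf using hE
  have : IsCover E (E.attach.image fun e => f e.1 e.2) := fun e he =>
    ⟨f e he, hf e he, Finset.mem_image.2 ⟨⟨e, he⟩, Finset.mem_attach _ _, rfl⟩⟩
  exact (coverNumber_le this).trans (Finset.card_image_le.trans_eq Finset.card_attach)

theorem coverNumber_filter_notMem (hC : C ∈ minCovers E) (hv : v ∈ C) :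
    coverNumber (E.filter (v ∉ ·)) + 1 = coverNumber E := by
  obtain ⟨h, hc⟩ := mem_minCovers.1 hC
  apply le_antisymm
  · have : IsCover (E.filter (v ∉ ·)) (C.erase v) := by
      intro e he
      obtain ⟨he, hve⟩ := Finset.mem_filter.1 he
      obtain ⟨x, hx, hxC⟩ := h e he
      exact ⟨x, hx, Finset.mem_erase.2 ⟨fun hxv => hve (hxv ▸ hx), hxC⟩⟩
    have h1 := coverNumber_le this
    have h2 := Finset.card_erase_add_one hv
    omega
  · have hne : {k | ∃ C, IsCover (E.filter (v ∉ ·)) C ∧ C.card = k}.Nonempty :=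
      ⟨_, C, fun e he => h e (Finset.mem_filter.1 he).1, rfl⟩
    obtain ⟨D, hD, hd⟩ := Nat.sInf_mem hne
    have : IsCover E (insert v D) := by
      intro e he
      by_cases hve : v ∈ e
      · exact ⟨v, hve, Finset.mem_insert_self _ _⟩
      · obtain ⟨x, hx, hxD⟩ := hD e (Finset.mem_filter.2 ⟨he, hve⟩)
        exact ⟨x, hx, Finset.mem_insert_of_mem hxD⟩
    have h1 := coverNumber_le this
    have h2 := Finset.card_insert_le v D
    have h3 : D.card = coverNumber (E.filter (v ∉ ·)) := hd
    omega

theorem card_filter_mem_minCovers_le (v : α) :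
    ((minCovers E).filter (v ∈ ·)).card ≤ (minCovers (E.filter (v ∉ ·))).card := by
  refine Finset.card_le_card_of_injOn (fun C => C.erase v) ?_ ?_
  · intro C hC
    obtain ⟨hC, hv⟩ := Finset.mem_filter.1 hC
    have h1 := coverNumber_filter_notMem hC hv
    obtain ⟨h, hc⟩ := mem_minCovers.1 hC
    refine Finset.mem_coe.2 (mem_minCovers.2 ⟨?_, ?_⟩)
    · intro e he
      obtain ⟨he, hve⟩ := Finset.mem_filter.1 he
      obtain ⟨x, hx, hxC⟩ := h e he
      exact ⟨x, hx, Finset.mem_erase.2 ⟨fun hxv => hve (hxv ▸ hx), hxC⟩⟩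
    · have h2 := Finset.card_erase_add_one hv
      simp only
      omega
  · intro C hC D hD hCD
    have h1 := (Finset.mem_filter.1 hC).2
    have h2 := (Finset.mem_filter.1 hD).2
    rw [← Finset.insert_erase h1, ← Finset.insert_erase h2]
    exact congrArg (insert v) hCD

theorem maxSpan_mono {E' : Finset (Finset α)} (h : E ⊆ E') (i : ℕ) :
    maxSpan E i ≤ maxSpan E' i :=
  Finset.sup_mono (Finset.powersetCard_mono h)

theorem le_maxSpan {T : Finset (Finset α)} (hT : T ⊆ E) :
    (T.sup id).card ≤ maxSpan E T.card :=
  Finset.le_sup (f := fun T : Finset (Finset α) => (T.sup id).card)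
    (Finset.mem_powersetCard.2 ⟨hT, rfl⟩)

theorem exists_edge_eq_pair (h2 : ∀ e ∈ E, e.card = 2) {e : Finset α} (he : e ∈ E) (hv : v ∈ e) :
    ∃ w, w ≠ v ∧ e = {v, w} := by
  obtain ⟨a, b, hab, rfl⟩ := Finset.card_eq_two.1 (h2 e he)
  rcases Finset.mem_insert.1 hv with rfl | hv
  · exact ⟨b, hab.symm, rfl⟩
  · obtain rfl := Finset.mem_singleton.1 hv
    exact ⟨a, hab, Finset.pair_comm _ _⟩

/-- Hall's condition for matching the vertices outside of a smallest cover `C` into `C`: if each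
vertex of a set `A` outside of `C` lies on some other smallest vertex cover, then `A` has at
least `|A|` neighbours. Otherwise, with `C'` a smallest cover through a vertex of a minimal
counterexample `A`, the set `(C' ∪ N(A)) \ A` would be a smaller cover. -/
theorem card_le_card_neighbors (h2 : ∀ e ∈ E, e.card = 2) (hC : C ∈ minCovers E) (A : Finset α)
    (hAC : Disjoint A C) (hA : ∀ a ∈ A, ∃ C' ∈ minCovers E, a ∈ C') :
    A.card ≤ (C.filter fun y => ∃ x ∈ A, {x, y} ∈ E).card := by
  induction A using Finset.strongInduction with
  | H A ih =>
    rcases A.eq_empty_or_nonempty with rfl | ⟨a, ha⟩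
    · simp
    obtain ⟨C', hC', haC'⟩ := hA a ha
    obtain ⟨hCc, -⟩ := mem_minCovers.1 hC
    obtain ⟨hc', hcard'⟩ := mem_minCovers.1 hC'
    set N := C.filter fun y => ∃ x ∈ A, {x, y} ∈ E with hN
    have hdisj : ∀ x ∈ A, x ∉ C := fun x hx => Finset.disjoint_left.1 hAC hx
    have hNA : Disjoint N A :=
      hAC.symm.mono_left (Finset.filter_subset _ _)
    have hcov : IsCover E ((C' ∪ N) \ A) := by
      intro e he
      by_cases hm : ∃ x ∈ e, x ∈ A
      · obtain ⟨x, hxe, hxA⟩ := hm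
        obtain ⟨w, -, rfl⟩ := exists_edge_eq_pair h2 he hxe
        have hw : w ∈ C := by
          obtain ⟨y, hy, hyC⟩ := hCc _ he
          rcases Finset.mem_insert.1 hy with rfl | hy
          · exact absurd hyC (hdisj _ hxA)
          · rwa [Finset.mem_singleton.1 hy] at hyC
        have hwN : w ∈ N := Finset.mem_filter.2 ⟨hw, x, hxA, he⟩
        exact ⟨w, by simp, Finset.mem_sdiff.2 ⟨Finset.mem_union_right _ hwN,
          Finset.disjoint_left.1 hNA hwN⟩⟩
      · push Not at hm
        obtain ⟨x, hx, hxC⟩ := hc' e he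
        exact ⟨x, hx, Finset.mem_sdiff.2 ⟨Finset.mem_union_left _ hxC, hm x hx⟩⟩
    have h1 := coverNumber_le hcov
    have hsub : (C' ∪ N) \ A = (C' \ A) ∪ (N \ C') := by
      ext x
      have : x ∈ N → x ∉ A := fun hx => Finset.disjoint_left.1 hNA hx
      simp only [Finset.mem_sdiff, Finset.mem_union]
      tauto
    have h3 : ((C' ∪ N) \ A).card ≤ (C' \ A).card + (N \ C').card := by
      rw [hsub]; exact Finset.card_union_le _ _
    have h4 := Finset.card_sdiff_add_card_inter C' A
    have h5 := ih (A \ C') (Finset.ssubset_iff_subset_ne.2 ⟨Finset.sdiff_subset, fun h =>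
      (Finset.mem_sdiff.1 (h ▸ ha)).2 haC'⟩) (hAC.mono_left Finset.sdiff_subset)
      (fun x hx => hA x (Finset.mem_sdiff.1 hx).1)
    have h6 : (C.filter fun y => ∃ x ∈ A \ C', {x, y} ∈ E) ⊆ N ∩ C' := by
      intro y hy
      obtain ⟨hyC, x, hx, he⟩ := Finset.mem_filter.1 hy
      obtain ⟨hxA, hxC'⟩ := Finset.mem_sdiff.1 hx
      refine Finset.mem_inter.2 ⟨Finset.mem_filter.2 ⟨hyC, x, hxA, he⟩, ?_⟩
      obtain ⟨z, hz, hzC⟩ := hc' _ he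
      rcases Finset.mem_insert.1 hz with rfl | hz
      · exact absurd hzC hxC'
      · rwa [Finset.mem_singleton.1 hz] at hzC
    have h7 := Finset.card_le_card h6
    have h8 := Finset.card_sdiff_add_card_inter N C'
    have h9 := Finset.card_sdiff_add_card_inter A C'
    rw [Finset.inter_comm] at h9
    omega

/-- The vertices that lie on some smallest vertex cover are spanned by `coverNumber E` edges: match
those outside of a fixed smallest cover `C` into `C` by Hall's theorem and take private edges at the
unmatched vertices of `C`. -/
theorem card_sup_minCovers_le_maxSpan (h2 : ∀ e ∈ E, e.card = 2) :
    ((minCovers E).sup id).card ≤ maxSpan E (coverNumber E) := by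
  obtain ⟨C, hC⟩ := minCovers_nonempty (E := E)
    fun e he => Finset.card_pos.1 (by rw [h2 e he]; norm_num)
  set X := (minCovers E).sup id \ C with hX
  have hall := (Finset.all_card_le_biUnion_card_iff_exists_injective
    (fun x : X => C.filter fun y => {x.1, y} ∈ E)).1 (by
      intro s
      have h := card_le_card_neighbors h2 hC (s.map (Function.Embedding.subtype _))
        (by
          rw [Finset.disjoint_left]
          intro a ha
          obtain ⟨b, -, rfl⟩ := Finset.mem_map.1 ha
          exact (Finset.mem_sdiff.1 b.2).2)
        (by
          intro a ha
          obtain ⟨b, -, rfl⟩ := Finset.mem_map.1 ha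
          obtain ⟨C', h1, h2⟩ := Finset.mem_sup.1 (Finset.mem_sdiff.1 b.2).1
          exact ⟨C', h1, h2⟩)
      rw [Finset.card_map] at h
      refine h.trans (Finset.card_le_card ?_)
      intro y hy
      obtain ⟨hy, x, hx, he⟩ := Finset.mem_filter.1 hy
      obtain ⟨b, hb, rfl⟩ := Finset.mem_map.1 hx
      exact Finset.mem_biUnion.2 ⟨b, hb, Finset.mem_filter.2 ⟨hy, he⟩⟩)
  obtain ⟨f, hf, hfm⟩ := hall
  have key : ∀ v ∈ C, ∃ e ∈ E, e ∩ C = {v} ∧ ∀ x, f x = v → x.1 ∈ e := by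
    intro v hv
    by_cases hx : ∃ x, f x = v
    · obtain ⟨x, rfl⟩ := hx
      refine ⟨_, (Finset.mem_filter.1 (hfm x)).2, ?_, fun y hy => by simp [hf hy]⟩
      ext z
      simp only [Finset.mem_inter, Finset.mem_insert, Finset.mem_singleton]
      constructor
      · rintro ⟨rfl | rfl, h⟩
        · exact absurd h (Finset.mem_sdiff.1 x.2).2
        · rfl
      · rintro rfl
        exact ⟨Or.inr rfl, hv⟩
    · obtain ⟨e, he, h⟩ := exists_private_edge hC hv
      exact ⟨e, he, h, fun x hxv => absurd ⟨x, hxv⟩ hx⟩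
  choose! g hgE hgC hgX using key
  have hinj : Set.InjOn g C := by
    intro v hv w hw h
    have := hgC v hv
    rw [h, hgC w hw] at this
    exact (Finset.singleton_injective this).symm
  have hT : C.image g ⊆ E := Finset.image_subset_iff.2 hgE
  have h1 := le_maxSpan hT
  rw [Finset.card_image_of_injOn hinj, (mem_minCovers.1 hC).2] at h1
  refine le_trans (Finset.card_le_card ?_) h1
  intro x hx
  by_cases hxC : x ∈ C
  · have : x ∈ g x ∩ C := by rw [hgC x hxC]; simp
    exact Finset.mem_sup.2 ⟨g x, Finset.mem_image_of_mem _ hxC, (Finset.mem_inter.1 this).1⟩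
  · let y : X := ⟨x, Finset.mem_sdiff.2 ⟨hx, hxC⟩⟩
    have hy : f y ∈ C := (Finset.mem_filter.1 (hfm y)).1
    exact Finset.mem_sup.2 ⟨g (f y), Finset.mem_image_of_mem _ hy, hgX _ hy y rfl⟩

/-- The upper bound for the number of smallest vertex covers of a graph, by induction on the cover
number: double counting pairs `v ∈ C` reduces to the graphs obtained by deleting the edges at `v`,
and there are at most `maxSpan E (coverNumber E)` vertices to delete. -/
theorem card_minCovers_mul_factorial_le (h2 : ∀ e ∈ E, e.card = 2) :
    (minCovers E).card * (coverNumber E).factorial ≤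
      ∏ i ∈ Finset.Icc 1 (coverNumber E), maxSpan E i := by
  generalize hc : coverNumber E = c
  induction c generalizing E with
  | zero =>
    have : minCovers E ⊆ {∅} := fun C hC => by
      have := (mem_minCovers.1 hC).2
      rw [hc, Finset.card_eq_zero] at this
      simp [this]
    simpa using Finset.card_le_card this
  | succ c ih =>
    have hdc : (c + 1) * (minCovers E).card =
        ∑ v ∈ (minCovers E).sup id, ((minCovers E).filter (v ∈ ·)).card := by
      have := Finset.sum_card_bipartiteAbove_eq_sum_card_bipartiteBelow
        (s := (minCovers E).sup id) (t := minCovers E) (fun v C => v ∈ C)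
      simp only [Finset.bipartiteAbove, Finset.bipartiteBelow] at this
      rw [this, mul_comm, ← smul_eq_mul, ← Finset.sum_const]
      refine Finset.sum_congr rfl fun C hC => ?_
      rw [← hc, ← (mem_minCovers.1 hC).2]
      congr 1
      ext v
      simp only [Finset.mem_filter]
      exact ⟨fun hv => ⟨Finset.mem_sup.2 ⟨C, hC, hv⟩, hv⟩, fun h => h.2⟩
    have hstep : ∀ v ∈ (minCovers E).sup id,
        ((minCovers E).filter (v ∈ ·)).card * c.factorial ≤
          ∏ i ∈ Finset.Icc 1 c, maxSpan E i := by
      intro v hv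
      obtain ⟨C, hC, hvC⟩ := Finset.mem_sup.1 hv
      have h1 := coverNumber_filter_notMem hC hvC
      have h3 := ih (E := E.filter (v ∉ ·)) (fun e he => h2 e (Finset.mem_filter.1 he).1)
        (by omega)
      refine le_trans (Nat.mul_le_mul_right _ (card_filter_mem_minCovers_le v)) (h3.trans ?_)
      exact Finset.prod_le_prod' fun i _ => maxSpan_mono (Finset.filter_subset _ _) i
    calc (minCovers E).card * (c + 1).factorial
        = ((c + 1) * (minCovers E).card) * c.factorial := by rw [Nat.factorial_succ]; ring
      _ = ∑ v ∈ (minCovers E).sup id,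
            ((minCovers E).filter (v ∈ ·)).card * c.factorial := by rw [hdc, Finset.sum_mul]
      _ ≤ ∑ _v ∈ (minCovers E).sup id, ∏ i ∈ Finset.Icc 1 c, maxSpan E i :=
          Finset.sum_le_sum hstep
      _ = ((minCovers E).sup id).card * ∏ i ∈ Finset.Icc 1 c, maxSpan E i := by
          rw [Finset.sum_const, smul_eq_mul]
      _ ≤ maxSpan E (c + 1) * ∏ i ∈ Finset.Icc 1 c, maxSpan E i :=
          Nat.mul_le_mul_right _ (hc ▸ card_sup_minCovers_le_maxSpan h2)
      _ = ∏ i ∈ Finset.Icc 1 (c + 1), maxSpan E i := by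
          rw [Finset.prod_Icc_succ_top (by omega), mul_comm]

end Covers

/-! ### Connectivity in codimension one and the lower bound -/

section Connectivity

variable {α : Type*} [DecidableEq α] {E E₁ E₂ : Finset (Finset α)} {C D : Finset α}

/-- A family of sets is connected in codimension one (relative to the size `c` of its members) if
it is not the union of two nonempty subfamilies such that no member of the first can be turned into
a member of the second by exchanging a single element. -/
def ConnectedInCodimOne (𝒞 : Finset (Finset α)) (c : ℕ) : Prop :=
  ∀ A ⊆ 𝒞, A.Nonempty → A ≠ 𝒞 → ∃ C ∈ A, ∃ D ∈ 𝒞, D ∉ A ∧ (C ∪ D).card ≤ c + 1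

/-- A family of edges is connected if it is not the union of two nonempty subfamilies with disjoint
supports. -/
def EdgeConnected (E : Finset (Finset α)) : Prop :=
  ∀ T ⊆ E, T.Nonempty → T ≠ E → ∃ e ∈ T, ∃ f ∈ E, f ∉ T ∧ ¬ Disjoint e f

/-- A connected family of `c`-sets without a common element has more than `c` members: enlarging a
subfamily by an adjacent member removes at most one element from its intersection. -/
theorem ConnectedInCodimOne.lt_card {𝒞 : Finset (Finset α)} {c : ℕ}
    (h : ConnectedInCodimOne 𝒞 c) (hne : 𝒞.Nonempty) (hcard : ∀ C ∈ 𝒞, C.card = c)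
    (havoid : ∀ C ∈ 𝒞, ∀ v ∈ C, ∃ D ∈ 𝒞, v ∉ D) : c + 1 ≤ 𝒞.card := by
  have key : ∀ k, k + 1 ≤ 𝒞.card → ∃ A ⊆ 𝒞, A.card = k + 1 ∧
      ∃ I : Finset α, (∀ C ∈ A, I ⊆ C) ∧ c ≤ k + I.card := by
    intro k
    induction k with
    | zero =>
      intro _
      obtain ⟨C, hC⟩ := hne
      exact ⟨{C}, by simpa using hC, by simp, C, by simp, by simp [hcard C hC]⟩
    | succ k ih =>
      intro hk
      obtain ⟨A, hA, hAc, I, hI, hIc⟩ := ih (by omega)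
      obtain ⟨C, hC, D, hD, hDA, hCD⟩ := h A hA (Finset.card_pos.1 (by omega))
        (by rintro rfl; omega)
      refine ⟨insert D A, Finset.insert_subset hD hA, by
        rw [Finset.card_insert_of_notMem hDA, hAc], I ∩ D, ?_, ?_⟩
      · intro C' hC'
        rcases Finset.mem_insert.1 hC' with rfl | hC'
        · exact Finset.inter_subset_right
        · exact Finset.inter_subset_left.trans (hI _ hC')
      · have h1 := Finset.card_sdiff_add_card_inter I D
        have h2 := Finset.card_le_card (Finset.sdiff_subset_sdiff (hI C hC) (Finset.Subset.refl D))
        have h3 := Finset.card_sdiff_add_card C D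
        have h4 := hcard D hD
        omega
  have hpos := Finset.card_pos.2 hne
  obtain ⟨A, hA, hAc, I, hI, hIc⟩ := key (𝒞.card - 1) (by omega)
  obtain rfl : A = 𝒞 := Finset.eq_of_subset_of_card_le hA (by omega)
  have : I = ∅ := by
    by_contra hIne
    obtain ⟨v, hv⟩ := Finset.nonempty_iff_ne_empty.2 hIne
    obtain ⟨C, hC⟩ := hne
    obtain ⟨D, hD, hvD⟩ := havoid C hC v (hI C hC hv)
    exact hvD (hI D hD hv)
  rw [this, Finset.card_empty] at hIc
  omega

theorem EdgeConnected.exists_span_le (h : EdgeConnected E) (h2 : ∀ e ∈ E, e.card = 2) (i : ℕ)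
    (hi : i ≤ E.card) : ∃ T ⊆ E, T.card = i ∧ (T.sup id).card ≤ i + 1 := by
  induction i with
  | zero => exact ⟨∅, by simp, by simp, by simp⟩
  | succ i ih =>
    obtain ⟨T, hT, hTc, hTs⟩ := ih (by omega)
    rcases T.eq_empty_or_nonempty with rfl | hne
    · obtain ⟨e, he⟩ := Finset.card_pos.1 (by omega : 0 < E.card)
      rw [Finset.card_empty] at hTc
      subst hTc
      exact ⟨{e}, by simpa using he, by simp, by simp [h2 e he]⟩
    · obtain ⟨e, he, f, hf, hfT, hef⟩ := h T hT hne (by rintro rfl; omega)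
      refine ⟨insert f T, Finset.insert_subset hf hT, by
        rw [Finset.card_insert_of_notMem hfT, hTc], ?_⟩
      obtain ⟨x, hxe, hxf⟩ := Finset.not_disjoint_iff.1 hef
      have h1 : (f \ T.sup id).card < f.card := Finset.card_lt_card
        (Finset.ssubset_iff_subset_ne.2 ⟨Finset.sdiff_subset, fun hh =>
          (Finset.mem_sdiff.1 (hh ▸ hxf)).2 (mem_support_of_mem he hxe)⟩)
      rw [h2 f hf] at h1
      rw [Finset.sup_insert, id, Finset.sup_eq_union, ← Finset.card_sdiff_add_card]
      omega

section Split

variable (hd : ∀ e ∈ E₁, ∀ f ∈ E₂, Disjoint e f)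

include hd

theorem disjoint_support : Disjoint (E₁.sup id) (E₂.sup id) := by
  rw [Finset.disjoint_left]
  intro x hx hx'
  obtain ⟨e, he, hxe⟩ := Finset.mem_sup.1 hx
  obtain ⟨f, hf, hxf⟩ := Finset.mem_sup.1 hx'
  exact Finset.disjoint_left.1 (hd e he f hf) hxe hxf

theorem union_inter_support (h₁ : C ⊆ E₁.sup id) (h₂ : D ⊆ E₂.sup id) :
    (C ∪ D) ∩ E₁.sup id = C := by
  have hdis := disjoint_support hd
  ext x
  have h1 := @h₁ x
  have h2 := @h₂ x
  have h3 : x ∈ E₁.sup id → x ∉ E₂.sup id := fun h => Finset.disjoint_left.1 hdis h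
  simp only [Finset.mem_inter, Finset.mem_union]
  tauto

theorem card_inter_support_add (h : C ⊆ (E₁ ∪ E₂).sup id) :
    (C ∩ E₁.sup id).card + (C ∩ E₂.sup id).card = C.card := by
  have hdis := disjoint_support hd
  rw [← Finset.card_union_of_disjoint (hdis.mono Finset.inter_subset_right
    Finset.inter_subset_right), ← Finset.inter_union_distrib_left]
  rw [Finset.sup_union, Finset.sup_eq_union] at h
  rw [Finset.inter_eq_left.2 h]

theorem coverNumber_union (hE : ∀ e ∈ E₁ ∪ E₂, e.Nonempty) :
    coverNumber (E₁ ∪ E₂) = coverNumber E₁ + coverNumber E₂ := by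
  obtain ⟨C₁, h₁⟩ := minCovers_nonempty fun e he => hE e (Finset.mem_union_left E₂ he)
  obtain ⟨C₂, h₂⟩ := minCovers_nonempty fun e he => hE e (Finset.mem_union_right E₁ he)
  obtain ⟨C, h⟩ := minCovers_nonempty hE
  obtain ⟨h₁, h₁'⟩ := mem_minCovers.1 h₁
  obtain ⟨h₂, h₂'⟩ := mem_minCovers.1 h₂
  have hs := card_inter_support_add hd (subset_support_of_mem_minCovers h)
  obtain ⟨h, h'⟩ := mem_minCovers.1 h
  apply le_antisymm
  · have : IsCover (E₁ ∪ E₂) (C₁ ∪ C₂) := by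
      intro e he
      rcases Finset.mem_union.1 he with he | he
      · exact (h₁ e he).imp fun x hx => ⟨hx.1, Finset.mem_union_left _ hx.2⟩
      · exact (h₂ e he).imp fun x hx => ⟨hx.1, Finset.mem_union_right _ hx.2⟩
    have h1 := coverNumber_le this
    have h2 := Finset.card_union_le C₁ C₂
    omega
  · have h1 : IsCover E₁ C := fun e he => h e (Finset.mem_union_left _ he)
    have h2 : IsCover E₂ C := fun e he => h e (Finset.mem_union_right _ he)
    have h1 := coverNumber_le h1.inter_support
    have h2 := coverNumber_le h2.inter_support
    omega

theorem inter_support_mem_minCovers (hE : ∀ e ∈ E₁ ∪ E₂, e.Nonempty)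
    (h : C ∈ minCovers (E₁ ∪ E₂)) : C ∩ E₁.sup id ∈ minCovers E₁ := by
  have hs := card_inter_support_add hd (subset_support_of_mem_minCovers h)
  have hu := coverNumber_union hd hE
  obtain ⟨h, h'⟩ := mem_minCovers.1 h
  have h1 : IsCover E₁ C := fun e he => h e (Finset.mem_union_left _ he)
  have h2 : IsCover E₂ C := fun e he => h e (Finset.mem_union_right _ he)
  have h3 := coverNumber_le h1.inter_support
  have h4 := coverNumber_le h2.inter_support
  exact mem_minCovers.2 ⟨h1.inter_support, by omega⟩

theorem union_mem_minCovers (hE : ∀ e ∈ E₁ ∪ E₂, e.Nonempty)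
    (h₁ : C ∈ minCovers E₁) (h₂ : D ∈ minCovers E₂) : C ∪ D ∈ minCovers (E₁ ∪ E₂) := by
  have hu := coverNumber_union hd hE
  obtain ⟨h₁, h₁'⟩ := mem_minCovers.1 h₁
  obtain ⟨h₂, h₂'⟩ := mem_minCovers.1 h₂
  have : IsCover (E₁ ∪ E₂) (C ∪ D) := by
    intro e he
    rcases Finset.mem_union.1 he with he | he
    · exact (h₁ e he).imp fun x hx => ⟨hx.1, Finset.mem_union_left _ hx.2⟩
    · exact (h₂ e he).imp fun x hx => ⟨hx.1, Finset.mem_union_right _ hx.2⟩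
  have h1 := coverNumber_le this
  have h2 := Finset.card_union_le C D
  exact mem_minCovers.2 ⟨this, by omega⟩

theorem card_minCovers_mul_le (hE : ∀ e ∈ E₁ ∪ E₂, e.Nonempty) :
    (minCovers E₁).card * (minCovers E₂).card ≤ (minCovers (E₁ ∪ E₂)).card := by
  rw [← Finset.card_product]
  have hd' : ∀ e ∈ E₂, ∀ f ∈ E₁, Disjoint e f := fun e he f hf => (hd f hf e he).symm
  refine Finset.card_le_card_of_injOn (fun p => p.1 ∪ p.2) ?_ ?_
  · intro p hp
    obtain ⟨h₁, h₂⟩ := Finset.mem_product.1 (Finset.mem_coe.1 hp)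
    exact Finset.mem_coe.2 (union_mem_minCovers hd hE h₁ h₂)
  · rintro ⟨C, D⟩ hp ⟨C', D'⟩ hp' h
    obtain ⟨h₁, h₂⟩ := Finset.mem_product.1 (Finset.mem_coe.1 hp)
    obtain ⟨h₁', h₂'⟩ := Finset.mem_product.1 (Finset.mem_coe.1 hp')
    replace h₁ := subset_support_of_mem_minCovers h₁
    replace h₂ := subset_support_of_mem_minCovers h₂
    replace h₁' := subset_support_of_mem_minCovers h₁'
    replace h₂' := subset_support_of_mem_minCovers h₂'
    simp only at h h₁ h₂ h₁' h₂'
    have e1 := union_inter_support hd h₁ h₂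
    have e2 := union_inter_support hd' h₂ h₁
    rw [h, union_inter_support hd h₁' h₂'] at e1
    rw [Finset.union_comm, h, Finset.union_comm, union_inter_support hd' h₂' h₁'] at e2
    rw [e1, e2]

theorem ConnectedInCodimOne.of_union (hE : ∀ e ∈ E₁ ∪ E₂, e.Nonempty)
    (h : ConnectedInCodimOne (minCovers (E₁ ∪ E₂)) (coverNumber (E₁ ∪ E₂))) :
    ConnectedInCodimOne (minCovers E₁) (coverNumber E₁) := by
  intro A hA hne hne'
  have hd' : ∀ e ∈ E₂, ∀ f ∈ E₁, Disjoint e f := fun e he f hf => (hd f hf e he).symm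
  have hu := coverNumber_union hd hE
  obtain ⟨C₂, h₂⟩ := minCovers_nonempty fun e he => hE e (Finset.mem_union_right E₁ he)
  have hcap : ∀ C ∈ minCovers E₁, (C ∪ C₂) ∩ E₁.sup id = C := fun C hC =>
    union_inter_support hd (subset_support_of_mem_minCovers hC) (subset_support_of_mem_minCovers h₂)
  obtain ⟨C, hC, D, hD, hDA, hCD⟩ := h ((minCovers (E₁ ∪ E₂)).filter (· ∩ E₁.sup id ∈ A))
    (Finset.filter_subset _ _)
    (by
      obtain ⟨C, hC⟩ := hne
      exact ⟨C ∪ C₂, Finset.mem_filter.2 ⟨union_mem_minCovers hd hE (hA hC) h₂, by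
        rwa [hcap C (hA hC)]⟩⟩)
    (by
      intro heq
      apply hne'
      refine Finset.Subset.antisymm hA fun D hD => ?_
      have hmem := union_mem_minCovers hd hE hD h₂
      rw [← heq] at hmem
      have := (Finset.mem_filter.1 hmem).2
      rwa [hcap D hD] at this)
  obtain ⟨hC, hCA⟩ := Finset.mem_filter.1 hC
  refine ⟨_, hCA, _, inter_support_mem_minCovers hd hE hD, fun hmem =>
    hDA (Finset.mem_filter.2 ⟨hD, hmem⟩), ?_⟩
  rw [← Finset.union_inter_distrib_right]
  have h1 := card_inter_support_add hd (Finset.union_subset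
    (subset_support_of_mem_minCovers hC) (subset_support_of_mem_minCovers hD))
  have hE' : ∀ e ∈ E₂ ∪ E₁, e.Nonempty := fun e he => hE e (by rwa [Finset.union_comm])
  have h3 := (mem_minCovers.1 (inter_support_mem_minCovers hd' hE' (C := C)
    (by rwa [Finset.union_comm]))).2
  have h4 := Finset.card_le_card (Finset.inter_subset_inter_right
    (u := E₂.sup id) (Finset.subset_union_left (s₁ := C) (s₂ := D)))
  omega

theorem exists_notMem_of_union (hE : ∀ e ∈ E₁ ∪ E₂, e.Nonempty)
    (h : ∀ v ∈ (E₁ ∪ E₂).sup id, ∃ C ∈ minCovers (E₁ ∪ E₂), v ∉ C) :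
    ∀ v ∈ E₁.sup id, ∃ C ∈ minCovers E₁, v ∉ C := by
  intro v hv
  have hsub : E₁.sup id ⊆ (E₁ ∪ E₂).sup id := Finset.sup_mono Finset.subset_union_left
  obtain ⟨C, hC, hvC⟩ := h v (hsub hv)
  exact ⟨_, inter_support_mem_minCovers hd hE hC, fun h => hvC (Finset.mem_inter.1 h).1⟩

end Split

/-- The connected components of `E` enter the lower bound only through the multiset `s` of their
cover numbers: `E` has at least `∏ (a + 1)` smallest vertex covers, and any part `t` of `s` gives
room for `i ≤ ∑ t` edges with at most `i + |t|` vertices. -/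
theorem exists_component_coverNumbers (h2 : ∀ e ∈ E, e.card = 2)
    (hconn : ConnectedInCodimOne (minCovers E) (coverNumber E))
    (havoid : ∀ v ∈ E.sup id, ∃ C ∈ minCovers E, v ∉ C) :
    ∃ s : Multiset ℕ, s.sum = coverNumber E ∧ (s.map (· + 1)).prod ≤ (minCovers E).card ∧
      ∀ t ≤ s, ∀ i ≤ t.sum, ∃ T ⊆ E, T.card = i ∧ (T.sup id).card ≤ i + t.card := by
  induction E using Finset.strongInduction with
  | H E ih =>
    have hEne : ∀ e ∈ E, e.Nonempty := fun e he => Finset.card_pos.1 (by rw [h2 e he]; norm_num)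
    have hne := minCovers_nonempty hEne
    by_cases hE : EdgeConnected E
    · rcases E.eq_empty_or_nonempty with rfl | hEn
      · refine ⟨0, ?_, ?_, ?_⟩
        · have : IsCover (∅ : Finset (Finset α)) ∅ := fun e he => absurd he (Finset.notMem_empty e)
          simpa using ((coverNumber_le this).antisymm (Nat.zero_le _)).symm
        · simpa using hne
        · intro t ht i hi
          obtain rfl := Multiset.le_zero.1 ht
          exact ⟨∅, by simp, (Nat.le_zero.1 (by simpa using hi)).symm, by simp⟩
      · refine ⟨{coverNumber E}, by simp, ?_, ?_⟩
        · simpa using hconn.lt_card hne (fun C hC => (mem_minCovers.1 hC).2)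
            fun C hC v hv => havoid v (subset_support_of_mem_minCovers hC hv)
        · intro t ht i hi
          rcases Multiset.le_singleton.1 ht with rfl | rfl
          · exact ⟨∅, by simp, (Nat.le_zero.1 (by simpa using hi)).symm, by simp⟩
          · simp only [Multiset.sum_singleton, Multiset.card_singleton] at hi ⊢
            exact hE.exists_span_le h2 i (hi.trans (coverNumber_le_card hEne))
    · unfold EdgeConnected at hE
      push Not at hE
      obtain ⟨T, hT, hTne, hTE, hTd⟩ := hE
      have hd : ∀ e ∈ T, ∀ f ∈ E \ T, Disjoint e f := fun e he f hf =>
        hTd e he f (Finset.mem_sdiff.1 hf).1 (Finset.mem_sdiff.1 hf).2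
      have hd' : ∀ e ∈ E \ T, ∀ f ∈ T, Disjoint e f := fun e he f hf => (hd f hf e he).symm
      have hu : T ∪ E \ T = E := Finset.union_sdiff_of_subset hT
      have hu' : E \ T ∪ T = E := Finset.sdiff_union_of_subset hT
      have hss : E \ T ⊂ E := Finset.sdiff_ssubset hT hTne
      obtain ⟨s₁, hs₁, hp₁, ht₁⟩ := ih T (Finset.ssubset_iff_subset_ne.2 ⟨hT, hTE⟩)
        (fun e he => h2 e (hT he)) (.of_union hd (by rwa [hu]) (by rwa [hu]))
        (exists_notMem_of_union hd (by rwa [hu]) (by rwa [hu]))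
      obtain ⟨s₂, hs₂, hp₂, ht₂⟩ := ih (E \ T) hss
        (fun e he => h2 e (hss.1 he)) (.of_union hd' (by rwa [hu']) (by rwa [hu']))
        (exists_notMem_of_union hd' (by rwa [hu']) (by rwa [hu']))
      refine ⟨s₁ + s₂, ?_, ?_, ?_⟩
      · rw [Multiset.sum_add, hs₁, hs₂, ← coverNumber_union hd (by rwa [hu]), hu]
      · rw [Multiset.map_add, Multiset.prod_add]
        have := card_minCovers_mul_le hd (by rwa [hu])
        rw [hu] at this
        exact (Nat.mul_le_mul hp₁ hp₂).trans this
      · intro t ht i hi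
        have hsplit : t - s₁ + t ∩ s₁ = t := Multiset.sub_add_inter t s₁
        have hsum : (t - s₁).sum + (t ∩ s₁).sum = t.sum := by rw [← Multiset.sum_add, hsplit]
        have hcard : (t - s₁).card + (t ∩ s₁).card = t.card := by
          rw [← Multiset.card_add, hsplit]
        obtain ⟨T₁, hT₁, hc₁, hb₁⟩ := ht₁ (t ∩ s₁) Multiset.inter_le_right
          (min i (t ∩ s₁).sum) (min_le_right _ _)
        obtain ⟨T₂, hT₂, hc₂, hb₂⟩ := ht₂ (t - s₁) (Multiset.sub_le_iff_le_add'.2 ht)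
          (i - min i (t ∩ s₁).sum) (by omega)
        refine ⟨T₁ ∪ T₂, Finset.union_subset (hT₁.trans hT) (hT₂.trans hss.1), ?_, ?_⟩
        · rw [Finset.card_union_of_disjoint, hc₁, hc₂]
          · omega
          · exact Finset.disjoint_sdiff.mono hT₁ hT₂
        · rw [Finset.sup_union, Finset.sup_eq_union]
          have := Finset.card_union_le (T₁.sup id) (T₂.sup id)
          omega

/-- Removing a smallest element `a` from `s`, the factors `m i / i` with `i > ∑ s - a` are at most
the factors `(k + 1) / k` with `1 ≤ k ≤ a` of `a + 1`. -/
theorem prod_le_of_le_add_card (m : ℕ → ℕ) (s : Multiset ℕ)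
    (h : ∀ t ≤ s, ∀ i ≤ t.sum, m i ≤ i + t.card) :
    ∏ i ∈ Finset.Icc 1 s.sum, m i ≤ (s.map (· + 1)).prod * s.sum.factorial := by
  generalize hn : s.card = n
  induction n generalizing s with
  | zero =>
    obtain rfl := Multiset.card_eq_zero.1 hn
    simp
  | succ n ih =>
    have hs0 : s ≠ 0 := by rintro rfl; simp at hn
    obtain ⟨a, ha, hmin⟩ : ∃ a ∈ s, ∀ b ∈ s, a ≤ b := by
      obtain ⟨a, ha, hmin⟩ := s.toFinset.exists_min_image id
        (Multiset.toFinset_nonempty.2 hs0)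
      exact ⟨a, Multiset.mem_toFinset.1 ha, fun b hb => hmin b (Multiset.mem_toFinset.2 hb)⟩
    obtain ⟨s', rfl⟩ := Multiset.exists_cons_of_mem ha
    have hn' : s'.card = n := by simpa using hn
    have hsum : n * a ≤ s'.sum := by
      have := Multiset.card_nsmul_le_sum (s := s') (a := a)
        fun b hb => hmin b (Multiset.mem_cons_of_mem hb)
      rwa [hn', smul_eq_mul] at this
    have ih' := ih s' (fun t ht => h t (ht.trans (Multiset.le_cons_self _ _))) hn'
    set p := (s'.map (· + 1)).prod with hp
    set S := s'.sum with hS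
    have key : ∀ k ≤ a, ∏ i ∈ Finset.Icc 1 (S + k), m i ≤ p * (k + 1) * (S + k).factorial := by
      intro k
      induction k with
      | zero => intro _; simpa using ih'
      | succ k ihk =>
        intro hk
        have h1 := ihk (by omega)
        have h2 := h (a ::ₘ s') le_rfl (S + (k + 1)) (by simp only [Multiset.sum_cons]; omega)
        rw [Multiset.card_cons, hn'] at h2
        rw [← add_assoc, Finset.prod_Icc_succ_top (by omega), Nat.factorial_succ]
        refine (Nat.mul_le_mul h1 h2).trans ?_
        have h3 : (k + 1) * n ≤ S := (Nat.mul_le_mul_right n hk).trans (by rwa [mul_comm])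
        have h4 : (k + 1) * (S + (k + 1) + (n + 1)) ≤ (k + 1 + 1) * (S + k + 1) := by nlinarith
        calc p * (k + 1) * (S + k).factorial * (S + (k + 1) + (n + 1))
            = p * (S + k).factorial * ((k + 1) * (S + (k + 1) + (n + 1))) := by ring
          _ ≤ p * (S + k).factorial * ((k + 1 + 1) * (S + k + 1)) := Nat.mul_le_mul_left _ h4
          _ = _ := by ring
    have := key a le_rfl
    rw [Multiset.sum_cons, Multiset.map_cons, Multiset.prod_cons, add_comm a, mul_comm (a + 1)]
    exact this

/-- The lower bound for the number of smallest vertex covers. -/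
theorem prod_le_card_minCovers_mul_factorial (h2 : ∀ e ∈ E, e.card = 2)
    (hconn : ConnectedInCodimOne (minCovers E) (coverNumber E))
    (havoid : ∀ v ∈ E.sup id, ∃ C ∈ minCovers E, v ∉ C) (m : ℕ → ℕ)
    (hm : ∀ T ⊆ E, m T.card ≤ (T.sup id).card) :
    ∏ i ∈ Finset.Icc 1 (coverNumber E), m i ≤
      (minCovers E).card * (coverNumber E).factorial := by
  obtain ⟨s, hs, hp, ht⟩ := exists_component_coverNumbers h2 hconn havoid
  have := prod_le_of_le_add_card m s fun t hts i hi => by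
    obtain ⟨T, hT, rfl, hb⟩ := ht t hts i hi
    exact (hm T hT).trans hb
  rw [hs] at this
  exact this.trans (Nat.mul_le_mul_right _ hp)

end Connectivity

/-! ### Depth and Hartshorne's connectedness theorem -/

section Depth

variable {R : Type*} [CommRing R] {J J₁ J₂ 𝔪 P : Ideal R} {f g : R}

/-- `f` is a nonzerodivisor on `R / J`. -/
def IsRegularMod (f : R) (J : Ideal R) : Prop :=
  ∀ x, f * x ∈ J → x ∈ J

/-- `R / J` admits a (weakly) regular sequence of length `r` consisting of elements of `𝔪`. -/
def HasDepth (𝔪 : Ideal R) : ℕ → Ideal R → Prop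
  | 0, _ => True
  | r + 1, J => ∃ f ∈ 𝔪, IsRegularMod f J ∧ HasDepth 𝔪 r (J ⊔ Ideal.span {f})

theorem mem_sup_span_singleton_iff {x : R} :
    x ∈ J ⊔ Ideal.span {f} ↔ ∃ y, x - f * y ∈ J := by
  constructor
  · intro h
    obtain ⟨j, hj, w, hw, rfl⟩ := Submodule.mem_sup.1 h
    obtain ⟨y, rfl⟩ := Ideal.mem_span_singleton'.1 hw
    exact ⟨y, by convert hj using 1; ring⟩
  · rintro ⟨y, hy⟩
    have := Ideal.add_mem _ (Ideal.mem_sup_left (T := Ideal.span {f}) hy)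
      (Ideal.mem_sup_right (S := J) (Ideal.mul_mem_right y _ (Ideal.mem_span_singleton_self f)))
    simpa using this

theorem isAssociatedPrime_quotient_iff [IsNoetherianRing R] :
    IsAssociatedPrime P (R ⧸ J) ↔ P.IsPrime ∧ ∃ x, ∀ r, r ∈ P ↔ r * x ∈ J := by
  rw [isAssociatedPrime_iff]
  refine and_congr_right fun _ => ⟨?_, ?_⟩
  · rintro ⟨x, rfl⟩
    obtain ⟨x, rfl⟩ := Ideal.Quotient.mk_surjective x
    refine ⟨x, fun r => ?_⟩
    rw [Submodule.mem_colon_singleton, Submodule.mem_bot, Algebra.smul_def,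
      Ideal.Quotient.algebraMap_eq, ← map_mul, Ideal.Quotient.eq_zero_iff_mem]
  · rintro ⟨x, hx⟩
    refine ⟨Ideal.Quotient.mk J x, ?_⟩
    ext r
    rw [hx, Submodule.mem_colon_singleton, Submodule.mem_bot, Algebra.smul_def,
      Ideal.Quotient.algebraMap_eq, ← map_mul, Ideal.Quotient.eq_zero_iff_mem]

theorem exists_isAssociatedPrime_ge [IsNoetherianRing R] {x : R} (hx : x ∉ J) :
    ∃ P, IsAssociatedPrime P (R ⧸ J) ∧ ∀ r, r * x ∈ J → r ∈ P := by
  obtain ⟨P, hP, hle⟩ := exists_le_isAssociatedPrime_of_isNoetherianRing R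
    (Ideal.Quotient.mk J x) (by rwa [Ne, Ideal.Quotient.eq_zero_iff_mem])
  refine ⟨P, hP, fun r hr => hle ?_⟩
  rwa [Submodule.mem_colon_singleton, Submodule.mem_bot, Algebra.smul_def,
      Ideal.Quotient.algebraMap_eq, ← map_mul, Ideal.Quotient.eq_zero_iff_mem]

theorem IsRegularMod.notMem [IsNoetherianRing R] (h : IsRegularMod f J)
    (hP : IsAssociatedPrime P (R ⧸ J)) : f ∉ P := by
  obtain ⟨hp, x, hx⟩ := isAssociatedPrime_quotient_iff.1 hP
  intro hf
  apply hp.ne_top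
  rw [Ideal.eq_top_iff_one, hx, one_mul]
  exact h x ((hx f).1 hf)

/-- Prime avoidance: an ideal that lies in no associated prime of finitely many quotients contains
an element that is a nonzerodivisor on all of them. -/
theorem exists_isRegularMod [IsNoetherianRing R] {𝒥 : Set (Ideal R)} (hfin : 𝒥.Finite)
    {B : Ideal R} (hB : ∀ J ∈ 𝒥, ∀ P, IsAssociatedPrime P (R ⧸ J) → ¬ B ≤ P) :
    ∃ f ∈ B, ∀ J ∈ 𝒥, IsRegularMod f J := by
  have hfin' : (⋃ J ∈ 𝒥, associatedPrimes R (R ⧸ J)).Finite :=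
    hfin.biUnion fun J _ => associatedPrimes.finite R (R ⧸ J)
  have := (Ideal.subset_union_prime_finite hfin' (f := id) (I := B) ⊥ ⊥ (by
    intro P hP _ _
    obtain ⟨J, -, hP⟩ := Set.mem_iUnion₂.1 hP
    exact IsAssociatedPrime.isPrime hP)).not.2 (by
      rintro ⟨P, hP, hle⟩
      obtain ⟨J, hJ, hP⟩ := Set.mem_iUnion₂.1 hP
      exact hB J hJ P hP hle)
  obtain ⟨f, hf, hfn⟩ := Set.not_subset.1 this
  refine ⟨f, hf, fun J hJ x hx => ?_⟩
  by_contra hxJ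
  obtain ⟨P, hP, hle⟩ := exists_isAssociatedPrime_ge hxJ
  exact hfn (Set.mem_iUnion₂.2 ⟨P, Set.mem_iUnion₂.2 ⟨J, hJ, hP⟩, hle f hx⟩)

theorem IsRegularMod.swap (hf : IsRegularMod f J) (hg : IsRegularMod g (J ⊔ Ideal.span {f})) :
    IsRegularMod f (J ⊔ Ideal.span {g}) := by
  intro x hx
  obtain ⟨y, hy⟩ := mem_sup_span_singleton_iff.1 hx
  obtain ⟨w, hw⟩ := mem_sup_span_singleton_iff.1 (hg y (mem_sup_span_singleton_iff.2
    ⟨x, by convert J.neg_mem hy using 1; ring⟩))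
  refine mem_sup_span_singleton_iff.2 ⟨w, hf _ ?_⟩
  convert J.add_mem hy (J.mul_mem_left g hw) using 1
  ring

/-- Elements killed by `𝔪` modulo `(J, f)` and modulo `(J, g)` correspond to each other via
`g x ≡ f y`; hence if there are none modulo `(J, g)`, there are none modulo `(J, f)`. -/
theorem mem_of_forall_mul_mem (hg : g ∈ 𝔪) (hfJ : IsRegularMod f J)
    (hgJ : IsRegularMod g J)
    (h : ∀ y, (∀ a ∈ 𝔪, a * y ∈ J ⊔ Ideal.span {g}) → y ∈ J ⊔ Ideal.span {g})
    {x : R} (hx : ∀ a ∈ 𝔪, a * x ∈ J ⊔ Ideal.span {f}) : x ∈ J ⊔ Ideal.span {f} := by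
  obtain ⟨y, hy⟩ := mem_sup_span_singleton_iff.1 (hx g hg)
  have hyg : y ∈ J ⊔ Ideal.span {g} := by
    refine h y fun a ha => ?_
    obtain ⟨w, hw⟩ := mem_sup_span_singleton_iff.1 (hx a ha)
    refine mem_sup_span_singleton_iff.2 ⟨w, hfJ _ ?_⟩
    convert J.sub_mem (J.mul_mem_left g hw) (J.mul_mem_left a hy) using 1
    ring
  obtain ⟨w, hw⟩ := mem_sup_span_singleton_iff.1 hyg
  refine mem_sup_span_singleton_iff.2 ⟨w, hgJ _ ?_⟩
  convert J.add_mem hy (J.mul_mem_left f hw) using 1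
  ring

theorem sup_span_right_comm (f g : R) :
    J ⊔ Ideal.span {f} ⊔ Ideal.span {g} = J ⊔ Ideal.span {g} ⊔ Ideal.span {f} := by
  rw [sup_assoc, sup_comm (Ideal.span {f}), ← sup_assoc]

/-- Depth drops by at most one modulo any nonzerodivisor `f ∈ 𝔪`: compare `f` with the first
element of a given regular sequence by means of a common nonzerodivisor `z`. -/
theorem HasDepth.sup_span [IsNoetherianRing R] {r : ℕ} (h : HasDepth 𝔪 (r + 1) J) (hf : f ∈ 𝔪)
    (hfJ : IsRegularMod f J) : HasDepth 𝔪 r (J ⊔ Ideal.span {f}) := by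
  induction r generalizing J f with
  | zero => trivial
  | succ r ih =>
    obtain ⟨g, hg, hgJ, hd⟩ := h
    obtain ⟨g', hg', hg'J, -⟩ := id hd
    have hmem : ∀ x, (∀ a ∈ 𝔪, a * x ∈ J ⊔ Ideal.span {f}) → x ∈ J ⊔ Ideal.span {f} := fun x hx =>
      mem_of_forall_mul_mem hg hfJ hgJ (fun y hy => hg'J y (hy g' hg')) hx
    obtain ⟨z, hz, hzreg⟩ := exists_isRegularMod (B := 𝔪)
      (𝒥 := {J, J ⊔ Ideal.span {g}, J ⊔ Ideal.span {f}}) (by simp) (by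
        rintro J' (rfl | rfl | rfl) P hP hle
        · exact hgJ.notMem hP (hle hg)
        · exact hg'J.notMem hP (hle hg')
        · obtain ⟨hp, x, hx⟩ := isAssociatedPrime_quotient_iff.1 hP
          apply hp.ne_top
          rw [Ideal.eq_top_iff_one, hx, one_mul]
          exact hmem x fun a ha => (hx a).1 (hle ha))
    have hz1 : IsRegularMod z J := hzreg _ (by simp)
    have hz2 : IsRegularMod z (J ⊔ Ideal.span {g}) := hzreg _ (by simp)
    have hz3 : IsRegularMod z (J ⊔ Ideal.span {f}) := hzreg _ (by simp)
    have hJz : HasDepth 𝔪 (r + 1) (J ⊔ Ideal.span {z}) :=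
      ⟨g, hg, hgJ.swap hz2, sup_span_right_comm (J := J) g z ▸ ih hd hz hz2⟩
    exact ⟨z, hz, hz3, sup_span_right_comm (J := J) z f ▸ ih hJz hf (hfJ.swap hz3)⟩

/-- In a local ring, the depth of `R / J` is at most the dimension of `R / P`, for each associated
prime `P` of `R / J`. -/
theorem HasDepth.le_coheight [IsNoetherianRing R] [IsLocalRing R] {r : ℕ}
    (h : HasDepth (IsLocalRing.maximalIdeal R) r J) (p : PrimeSpectrum R)
    (hp : IsAssociatedPrime p.asIdeal (R ⧸ J)) : (r : ℕ∞) ≤ Order.coheight p := by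
  induction r generalizing J p with
  | zero => simp
  | succ r ih =>
    obtain ⟨f, hf, hfJ, hd⟩ := h
    obtain ⟨-, x, hx⟩ := isAssociatedPrime_quotient_iff.1 hp
    -- The elements killed by `p` modulo `J`; by Nakayama, not all of them lie in `(J, f)`.
    let N : Ideal R := J.colon (p.asIdeal : Set R)
    have hN : ∀ {y}, y ∈ N ↔ ∀ a ∈ p.asIdeal, y * a ∈ J := by
      intro y
      exact Submodule.mem_colon
    obtain ⟨y, hyN, hy⟩ : ∃ y ∈ N, y ∉ J ⊔ Ideal.span {f} := by
      by_contra! hcon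
      have hle : N ≤ J ⊔ IsLocalRing.maximalIdeal R • N := by
        intro y hy
        obtain ⟨w, hw⟩ := mem_sup_span_singleton_iff.1 (hcon y hy)
        have hwN : w ∈ N := hN.2 fun a ha => hfJ _ (by
          convert J.sub_mem (hN.1 hy a ha) (J.mul_mem_right a hw) using 1
          ring)
        have := Ideal.add_mem _ (Ideal.mem_sup_left (T := IsLocalRing.maximalIdeal R • N) hw)
          (Ideal.mem_sup_right (S := J) (Submodule.smul_mem_smul hf hwN))
        simpa using this
      have hNJ := Submodule.le_of_le_smul_of_le_jacobson_bot (IsNoetherian.noetherian N)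
        (IsLocalRing.maximalIdeal_le_jacobson _) hle
      apply p.2.ne_top
      rw [Ideal.eq_top_iff_one, hx, one_mul]
      exact hNJ (hN.2 fun a ha => by rw [mul_comm]; exact (hx a).1 ha)
    obtain ⟨Q, hQ, hle⟩ := exists_isAssociatedPrime_ge hy
    let q : PrimeSpectrum R := ⟨Q, hQ.isPrime⟩
    have hpq : p < q := by
      refine lt_of_le_of_ne (fun a ha => hle a ?_) ?_
      · exact Ideal.mem_sup_left (by rw [mul_comm]; exact hN.1 hyN a ha)
      · rintro rfl
        exact hfJ.notMem hp (hle f (Ideal.mem_sup_right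
          (Ideal.mul_mem_right _ _ (Ideal.mem_span_singleton_self f))))
    have h1 := ih hd q hQ
    have h2 := Order.coheight_add_one_le hpq
    push_cast
    exact (add_le_add_left h1 1).trans h2

/-- The core of Hartshorne's connectedness theorem. Write `f = a + b` and `g = a' + b'` with
`a, a' ∈ J₁` and `b, b' ∈ J₂`. Then `g a ≡ f a'` modulo `J₁ ⊓ J₂`, so `a ≡ f u` for some `u` by
regularity, whence `(1 - u) a` and `u b` lie in `J₁ ⊓ J₂`; and `u` or `1 - u` is a unit. -/
theorem le_inf_or_le_inf_of_isRegularMod [IsLocalRing R] (hf : f ∈ J₁ ⊔ J₂) (hg : g ∈ J₁ ⊔ J₂)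
    (hfr : IsRegularMod f (J₁ ⊓ J₂)) (hgr : IsRegularMod g (J₁ ⊓ J₂ ⊔ Ideal.span {f})) :
    J₁ ≤ J₁ ⊓ J₂ ∨ J₂ ≤ J₁ ⊓ J₂ := by
  obtain ⟨a, ha, b, hb, rfl⟩ := Submodule.mem_sup.1 hf
  obtain ⟨a', ha', b', hb', rfl⟩ := Submodule.mem_sup.1 hg
  have h1 : a ∈ J₁ ⊓ J₂ ⊔ Ideal.span {a + b} := by
    refine hgr a (mem_sup_span_singleton_iff.2 ⟨a', ?_⟩)
    have e : (a' + b') * a - (a + b) * a' = b' * a - b * a' := by ring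
    rw [e]
    exact ⟨J₁.sub_mem (J₁.mul_mem_left _ ha) (J₁.mul_mem_left _ ha'),
      J₂.sub_mem (J₂.mul_mem_right _ hb') (J₂.mul_mem_right _ hb)⟩
  obtain ⟨u, hu⟩ := mem_sup_span_singleton_iff.1 h1
  have hub : b * u ∈ J₁ ⊓ J₂ := by
    refine ⟨?_, J₂.mul_mem_right _ hb⟩
    have := J₁.sub_mem (J₁.mul_mem_right (1 - u) ha) hu.1
    rwa [show a * (1 - u) - (a - (a + b) * u) = b * u by ring] at this
  have hua : a * (1 - u) ∈ J₁ ⊓ J₂ := by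
    convert Ideal.add_mem _ hu hub using 1
    ring
  rcases IsLocalRing.isUnit_or_isUnit_one_sub_self u with h | h
  · have hbI : b ∈ J₁ ⊓ J₂ := (Ideal.mul_unit_mem_iff_mem _ h).1 hub
    exact Or.inr fun x hx => hfr x ⟨J₁.mul_mem_right _ (J₁.add_mem ha hbI.1), J₂.mul_mem_left _ hx⟩
  · have haI : a ∈ J₁ ⊓ J₂ := (Ideal.mul_unit_mem_iff_mem _ h).1 hua
    exact Or.inl fun x hx => hfr x ⟨J₁.mul_mem_left _ hx, J₂.mul_mem_right _ (J₂.add_mem haI.2 hb)⟩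

/-- Hartshorne's connectedness theorem: if `R / (J₁ ⊓ J₂)` has depth at least `r` and `V(J₁ + J₂)`
has dimension at most `r - 2`, then one of `J₁`, `J₂` contains the other. -/
theorem HasDepth.le_inf_or_le_inf [IsNoetherianRing R] [IsLocalRing R] {r : ℕ}
    (h : HasDepth (IsLocalRing.maximalIdeal R) r (J₁ ⊓ J₂))
    (hdim : ∀ p : PrimeSpectrum R, J₁ ⊔ J₂ ≤ p.asIdeal → Order.coheight p + 2 ≤ r) :
    J₁ ≤ J₁ ⊓ J₂ ∨ J₂ ≤ J₁ ⊓ J₂ := by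
  by_cases h1 : J₁ = ⊤
  · right; simp [h1]
  by_cases h2 : J₂ = ⊤
  · left; simp [h2]
  have hle : J₁ ⊔ J₂ ≤ IsLocalRing.maximalIdeal R :=
    sup_le (IsLocalRing.le_maximalIdeal h1) (IsLocalRing.le_maximalIdeal h2)
  have h2r : (2 : ℕ∞) ≤ r :=
    le_add_self.trans (hdim (IsLocalRing.closedPoint R) hle)
  obtain ⟨s, rfl⟩ : ∃ s, r = s + 1 + 1 := ⟨r - 2, by
    have : 2 ≤ r := by exact_mod_cast h2r
    omega⟩
  have havoid : ∀ t : ℕ, s + 1 ≤ t → ∀ J, HasDepth (IsLocalRing.maximalIdeal R) t J →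
      ∀ P, IsAssociatedPrime P (R ⧸ J) → ¬ J₁ ⊔ J₂ ≤ P := by
    intro t ht J hJ P hP hle
    have h3 := hJ.le_coheight ⟨P, hP.isPrime⟩ hP
    have h4 := hdim ⟨P, hP.isPrime⟩ hle
    have h5 : (s + 1 + 2 : ℕ∞) ≤ s + 1 + 1 := by
      refine le_trans ?_ (h4.trans (by push_cast; exact le_rfl))
      gcongr
      refine le_trans ?_ h3
      exact_mod_cast ht
    have : s + 1 + 2 ≤ s + 1 + 1 := by exact_mod_cast h5
    omega
  obtain ⟨f, hf, hfr⟩ := exists_isRegularMod (Set.finite_singleton (J₁ ⊓ J₂)) (by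
    rintro J rfl
    exact havoid _ (by omega) _ h)
  have hfr := hfr _ rfl
  obtain ⟨g, hg, hgr⟩ := exists_isRegularMod (Set.finite_singleton (J₁ ⊓ J₂ ⊔ Ideal.span {f})) (by
    rintro J rfl
    exact havoid _ le_rfl _ (h.sup_span (hle hf) hfr))
  exact le_inf_or_le_inf_of_isRegularMod hf hg hfr (hgr _ rfl)

end Depth

/-! ### Height and dimension of monomial ideals -/

open MvPolynomial

section Variables

variable {σ K : Type*} [Field K]

theorem monomial_mem_prime_iff {Q : Ideal (MvPolynomial σ K)} [hQ : Q.IsPrime] {a : σ →₀ ℕ} :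
    monomial a (1 : K) ∈ Q ↔ ∃ v ∈ a.support, (X v : MvPolynomial σ K) ∈ Q := by
  rw [monomial_eq, C_1, one_mul, Finsupp.prod, hQ.prod_mem_iff]
  refine exists_congr fun v => and_congr_right fun hv => ?_
  exact hQ.pow_mem_iff_mem _ (Nat.pos_of_ne_zero (Finsupp.mem_support_iff.1 hv))

theorem height_add_coheight_le [Fintype σ] (p : PrimeSpectrum (MvPolynomial σ K)) :
    p.asIdeal.height + Order.coheight p ≤ Fintype.card σ := by
  have h1 := Order.krullDim_eq_iSup_height_add_coheight_of_nonempty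
    (α := PrimeSpectrum (MvPolynomial σ K))
  have h2 := ringKrullDim_of_isNoetherianRing (R := K) (ι := σ)
  rw [ringKrullDim_eq_zero_of_field, zero_add, Nat.card_eq_fintype_card, ringKrullDim, h1] at h2
  have h3 := le_iSup (fun a : PrimeSpectrum (MvPolynomial σ K) =>
    Order.height a + Order.coheight a) p
  rw [PrimeSpectrum.height_eq_orderHeight]
  refine h3.trans_eq ?_
  exact_mod_cast h2

variable [DecidableEq σ]

variable (K) in
/-- The prime ideal generated by the variables `X v` with `v ∈ Z`, encoded as the kernel of the
substitution of `0` for these variables. -/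
noncomputable def varIdeal (Z : Finset σ) : Ideal (MvPolynomial σ K) :=
  RingHom.ker (aeval (R := K) fun v => if v ∈ Z then 0 else (X v : MvPolynomial σ K))

instance (Z : Finset σ) : (varIdeal K Z).IsPrime := RingHom.ker_isPrime _

theorem X_mem_varIdeal {Z : Finset σ} {v : σ} :
    (X v : MvPolynomial σ K) ∈ varIdeal K Z ↔ v ∈ Z := by
  rw [varIdeal, RingHom.mem_ker, aeval_X]
  split_ifs with h <;> simp [h]

theorem varIdeal_le {Z : Finset σ} {Q : Ideal (MvPolynomial σ K)}
    (h : ∀ v ∈ Z, (X v : MvPolynomial σ K) ∈ Q) : varIdeal K Z ≤ Q := by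
  intro f hf
  have heq : (Ideal.Quotient.mkₐ K Q).comp (aeval fun v => if v ∈ Z then 0 else X v) =
      Ideal.Quotient.mkₐ K Q := by
    ext v
    rw [AlgHom.comp_apply, aeval_X]
    split_ifs with hv
    · rw [map_zero, eq_comm]
      exact Ideal.Quotient.eq_zero_iff_mem.2 (h v hv)
    · rfl
  have hf0 : aeval (R := K) (fun v => if v ∈ Z then 0 else (X v : MvPolynomial σ K)) f = 0 := hf
  have := DFunLike.congr_fun heq f
  rw [AlgHom.comp_apply, hf0, map_zero] at this
  exact Ideal.Quotient.eq_zero_iff_mem.1 this.symm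

theorem varIdeal_lt {Z : Finset σ} {v : σ} (hv : v ∉ Z) :
    varIdeal K Z < varIdeal K (insert v Z) := by
  refine lt_of_le_of_ne (varIdeal_le fun w hw => X_mem_varIdeal.2 (Finset.mem_insert_of_mem hw)) ?_
  intro h
  have h1 : (X v : MvPolynomial σ K) ∈ varIdeal K (insert v Z) :=
    X_mem_varIdeal.2 (Finset.mem_insert_self v Z)
  rw [← h] at h1
  exact hv (X_mem_varIdeal.1 h1)

theorem card_le_height {Z : Finset σ} {Q : Ideal (MvPolynomial σ K)} [Q.IsPrime]
    (h : ∀ v ∈ Z, (X v : MvPolynomial σ K) ∈ Q) : (Z.card : ℕ∞) ≤ Q.height := by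
  refine le_trans ?_ (Ideal.height_mono (varIdeal_le h))
  clear h
  induction Z using Finset.induction_on with
  | empty => simp
  | insert v Z hv ih =>
    rw [Finset.card_insert_of_notMem hv]
    push_cast
    exact (add_le_add_left ih 1).trans
      (Ideal.height_add_one_le_of_lt_of_isPrime (varIdeal_lt hv))

variable [Fintype σ]

theorem coheight_add_card_le {Z : Finset σ} {p : PrimeSpectrum (MvPolynomial σ K)}
    (h : ∀ v ∈ Z, (X v : MvPolynomial σ K) ∈ p.asIdeal) :
    Order.coheight p + Z.card ≤ Fintype.card σ := by
  rw [add_comm]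
  exact (add_le_add_left (card_le_height h) _).trans (height_add_coheight_le p)

theorem card_le_card_add_coheight (Z : Finset σ) :
    (Fintype.card σ : ℕ∞) ≤ Z.card + Order.coheight
      (⟨varIdeal K Z, inferInstance⟩ : PrimeSpectrum (MvPolynomial σ K)) := by
  generalize hk : Fintype.card σ - Z.card = k
  induction k generalizing Z with
  | zero =>
    refine le_trans ?_ le_self_add
    exact_mod_cast Nat.sub_eq_zero_iff_le.1 hk
  | succ k ih =>
    obtain ⟨v, hv⟩ : ∃ v, v ∉ Z := by
      by_contra! h
      rw [Finset.eq_univ_iff_forall.2 h, Finset.card_univ] at hk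
      omega
    have h1 := ih (insert v Z) (by rw [Finset.card_insert_of_notMem hv]; omega)
    rw [Finset.card_insert_of_notMem hv] at h1
    have hlt : (⟨varIdeal K Z, inferInstance⟩ : PrimeSpectrum (MvPolynomial σ K)) <
        ⟨varIdeal K (insert v Z), inferInstance⟩ := varIdeal_lt hv
    have h2 := Order.coheight_add_one_le hlt
    refine h1.trans ?_
    push_cast
    rw [add_assoc, add_comm 1]
    gcongr

theorem height_varIdeal (Z : Finset σ) : (varIdeal K Z).height = Z.card := by
  refine le_antisymm ?_ (card_le_height fun v hv => X_mem_varIdeal.2 hv)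
  have h1 := height_add_coheight_le ⟨varIdeal K Z, inferInstance⟩
  have h2 := card_le_card_add_coheight (K := K) Z
  have h3 := h1.trans h2
  refine (ENat.add_le_add_iff_right ?_).1 h3
  intro htop
  rw [htop, add_top] at h1
  exact absurd h1 (by simp)

end Variables

section MonomialIdeal

variable {σ K : Type*} [Field K]

/-- A set of variables that meets the support of each of the monomials in `A`. -/
def IsVarCover (A : Finset (σ →₀ ℕ)) (Z : Finset σ) : Prop :=
  ∀ a ∈ A, ∃ v ∈ a.support, v ∈ Z

variable (K) in
/-- The ideal generated by the monomials with exponent vectors in `A`. -/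
noncomputable def monIdeal (A : Finset (σ →₀ ℕ)) : Ideal (MvPolynomial σ K) :=
  Ideal.span ((fun a => monomial a (1 : K)) '' (A : Set (σ →₀ ℕ)))

variable {A : Finset (σ →₀ ℕ)}

theorem mem_monIdeal_iff {p : MvPolynomial σ K} :
    p ∈ monIdeal K A ↔ ∀ b ∈ p.support, ∃ a ∈ A, a ≤ b := by
  rw [monIdeal, mem_ideal_span_monomial_image]
  simp

theorem monomial_mem_monIdeal_iff {b : σ →₀ ℕ} :
    monomial b (1 : K) ∈ monIdeal K A ↔ ∃ a ∈ A, a ≤ b := by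
  classical
  rw [mem_monIdeal_iff, support_monomial, if_neg one_ne_zero]
  simp

theorem monomial_mem_monIdeal {a : σ →₀ ℕ} (ha : a ∈ A) : monomial a (1 : K) ∈ monIdeal K A :=
  monomial_mem_monIdeal_iff.2 ⟨a, ha, le_rfl⟩

open Classical in
theorem isVarCover_of_monIdeal_le [Fintype σ] {Q : Ideal (MvPolynomial σ K)} [Q.IsPrime]
    (h : monIdeal K A ≤ Q) :
    IsVarCover A (Finset.univ.filter fun v => (X v : MvPolynomial σ K) ∈ Q) := by
  intro a ha
  obtain ⟨v, hv, hvQ⟩ := monomial_mem_prime_iff.1 (h (monomial_mem_monIdeal ha))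
  exact ⟨v, hv, by simpa using hvQ⟩

variable [DecidableEq σ]

theorem monIdeal_le_varIdeal {Z : Finset σ} (h : IsVarCover A Z) :
    monIdeal K A ≤ varIdeal K Z := by
  rw [monIdeal, Ideal.span_le]
  rintro _ ⟨a, ha, rfl⟩
  obtain ⟨v, hv, hvZ⟩ := h a ha
  exact monomial_mem_prime_iff.2 ⟨v, hv, X_mem_varIdeal.2 hvZ⟩

variable [Fintype σ]

theorem height_monIdeal {c : ℕ} (hc : ∀ Z, IsVarCover A Z → c ≤ Z.card) {Z : Finset σ}
    (hZ : IsVarCover A Z) (hZc : Z.card = c) : (monIdeal K A).height = c := by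
  classical
  apply le_antisymm
  · refine (Ideal.height_mono (monIdeal_le_varIdeal hZ)).trans ?_
    rw [height_varIdeal, hZc]
  · rw [Ideal.height_eq_inf_minimalPrimes]
    refine le_iInf₂ fun Q hQ => ?_
    have := hQ.1.1
    refine le_trans ?_ (card_le_height (Z := Finset.univ.filter fun v => X v ∈ Q) (by simp))
    exact_mod_cast hc _ (isVarCover_of_monIdeal_le hQ.1.2)

theorem ringKrullDim_quotient_monIdeal {c : ℕ} (hc : ∀ Z, IsVarCover A Z → c ≤ Z.card)
    {Z : Finset σ} (hZ : IsVarCover A Z) (hZc : Z.card = c) :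
    ringKrullDim (MvPolynomial σ K ⧸ monIdeal K A) = (Fintype.card σ - c : ℕ) := by
  classical
  have hcn : c ≤ Fintype.card σ := hZc ▸ Finset.card_le_univ Z
  rw [ringKrullDim_quotient]
  have hmem : (⟨varIdeal K Z, inferInstance⟩ : PrimeSpectrum (MvPolynomial σ K)) ∈
      PrimeSpectrum.zeroLocus (monIdeal K A : Set (MvPolynomial σ K)) := monIdeal_le_varIdeal hZ
  apply le_antisymm
  · refine iSup_le fun l => ?_
    have h1 : (l.length : ℕ∞) ≤ Order.coheight l.head.1 :=
      Order.length_le_coheight (p := l.map Subtype.val fun _ _ h => h) le_rfl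
    have h2 := l.head.1.2
    have h3 := coheight_add_card_le (p := l.head.1)
      (Z := Finset.univ.filter fun v => X v ∈ l.head.1.asIdeal) (by simp)
    have h4 := hc _ (isVarCover_of_monIdeal_le (Q := l.head.1.asIdeal) l.head.2)
    have h5 : (l.length + c : ℕ∞) ≤ Fintype.card σ := by
      refine le_trans (add_le_add h1 ?_) h3
      exact_mod_cast h4
    have h6 : l.length + c ≤ Fintype.card σ := by exact_mod_cast h5
    exact_mod_cast (by omega : l.length ≤ Fintype.card σ - c)
  · have h1 := card_le_card_add_coheight (K := K) Z
    have h2 : ((Fintype.card σ - c : ℕ) : ℕ∞) ≤ Order.coheight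
        (⟨varIdeal K Z, inferInstance⟩ : PrimeSpectrum (MvPolynomial σ K)) := by
      rw [hZc] at h1
      refine (ENat.add_le_add_iff_left (ENat.natCast_ne_top c)).1 (le_trans ?_ h1)
      exact_mod_cast (by omega : c + (Fintype.card σ - c) ≤ Fintype.card σ)
    obtain ⟨p, hp, hpl⟩ := Order.exists_series_of_le_coheight _ h2
    let q : LTSeries (PrimeSpectrum.zeroLocus (monIdeal K A : Set (MvPolynomial σ K))) :=
      { length := p.length
        toFun := fun i => ⟨p i, (le_trans hmem (hp ▸ p.head_le i : _ ≤ p i) :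
          monIdeal K A ≤ (p i).asIdeal)⟩
        step := fun i => p.step i }
    rw [← hpl]
    exact le_iSup (fun l : LTSeries (PrimeSpectrum.zeroLocus
      (monIdeal K A : Set (MvPolynomial σ K))) => (l.length : WithBot ℕ∞)) q

end MonomialIdeal

/-! ### Polarization, Taylor shifts and the Hilbert series -/

section Polarization

variable {σ : Type*}

theorem apply_le_two {A : Finset (σ →₀ ℕ)} (hA : ∀ a ∈ A, a.degree = 2) {a : σ →₀ ℕ}
    (ha : a ∈ A) (v : σ) : a v ≤ 2 :=
  hA a ha ▸ Finsupp.le_degree v a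

variable [Fintype σ]

/-- The polarization of the monomial with exponent vector `a`, a squarefree monomial in the
variables `⟨v, k⟩`, encoded as its support: `X v ^ m` becomes `⟨v, 0⟩ ⟨v, 1⟩ ⋯ ⟨v, m - 1⟩`. -/
def polarize (a : σ →₀ ℕ) : Finset (Σ _ : σ, ℕ) :=
  Finset.univ.sigma fun v => Finset.range (a v)

theorem mem_polarize {a : σ →₀ ℕ} {v : σ} {k : ℕ} :
    (⟨v, k⟩ : Σ _ : σ, ℕ) ∈ polarize a ↔ k < a v := by
  simp [polarize]

theorem card_polarize (a : σ →₀ ℕ) : (polarize a).card = a.degree := by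
  simp [polarize, Finset.card_sigma, Finsupp.degree_eq_sum]

theorem polarize_injective : Function.Injective (polarize (σ := σ)) := by
  intro a b h
  ext v
  apply le_antisymm <;> by_contra! hlt
  · exact lt_irrefl _ (mem_polarize.1 (h ▸ mem_polarize.2 hlt))
  · exact lt_irrefl _ (mem_polarize.1 (h ▸ mem_polarize.2 hlt))

variable [DecidableEq σ]

theorem polarize_sup (T : Finset (σ →₀ ℕ)) :
    polarize (T.sup id) = (T.image polarize).sup id := by
  rw [Finset.sup_image, Function.id_comp]
  refine Finset.apply_sup_eq_sup_comp polarize ?_ ?_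
  · intro a b
    ext ⟨v, k⟩
    simp [mem_polarize]
  · ext ⟨v, k⟩
    simp [mem_polarize, bot_eq_zero]

/-- The graph whose edges are the polarizations of the monomials in `A`. -/
def polarEdges (A : Finset (σ →₀ ℕ)) : Finset (Finset (Σ _ : σ, ℕ)) :=
  A.image polarize

variable {A : Finset (σ →₀ ℕ)}

theorem card_of_mem_polarEdges (hA : ∀ a ∈ A, a.degree = 2) :
    ∀ e ∈ polarEdges A, e.card = 2 := by
  intro e he
  obtain ⟨a, ha, rfl⟩ := Finset.mem_image.1 he
  rw [card_polarize, hA a ha]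

theorem nonempty_of_mem_polarEdges (hA : ∀ a ∈ A, a.degree = 2) :
    ∀ e ∈ polarEdges A, e.Nonempty := fun e he =>
  Finset.card_pos.1 (by rw [card_of_mem_polarEdges hA e he]; norm_num)

theorem isCover_polarEdges_iff {C : Finset (Σ _ : σ, ℕ)} :
    IsCover (polarEdges A) C ↔ ∀ a ∈ A, ∃ v k, k < a v ∧ (⟨v, k⟩ : Σ _ : σ, ℕ) ∈ C := by
  simp [IsCover, polarEdges, Sigma.exists, mem_polarize]

theorem IsCover.isVarCover {C : Finset (Σ _ : σ, ℕ)} (h : IsCover (polarEdges A) C) :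
    IsVarCover A (C.image Sigma.fst) := by
  intro a ha
  obtain ⟨v, k, hk, hC⟩ := isCover_polarEdges_iff.1 h a ha
  exact ⟨v, Finsupp.mem_support_iff.2 (by omega), Finset.mem_image.2 ⟨_, hC, rfl⟩⟩

theorem coverNumber_le_card_of_isVarCover {Z : Finset σ} (h : IsVarCover A Z) :
    coverNumber (polarEdges A) ≤ Z.card := by
  have : IsCover (polarEdges A) (Z.image fun v => ⟨v, 0⟩) := by
    refine isCover_polarEdges_iff.2 fun a ha => ?_
    obtain ⟨v, hv, hvZ⟩ := h a ha
    exact ⟨v, 0, Nat.pos_of_ne_zero (Finsupp.mem_support_iff.1 hv), Finset.mem_image_of_mem _ hvZ⟩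
  exact (coverNumber_le this).trans Finset.card_image_le

theorem exists_isVarCover (hA : ∀ a ∈ A, a.degree = 2) :
    ∃ Z, IsVarCover A Z ∧ Z.card = coverNumber (polarEdges A) := by
  obtain ⟨C, hC⟩ := minCovers_nonempty (nonempty_of_mem_polarEdges hA)
  obtain ⟨hC, hc⟩ := mem_minCovers.1 hC
  exact ⟨_, hC.isVarCover, (Finset.card_image_le.trans_eq hc).antisymm
    (coverNumber_le_card_of_isVarCover hC.isVarCover)⟩

end Polarization

section Taylor

variable {σ K : Type*} [Field K] {A : Finset (σ →₀ ℕ)}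

theorem minGens_monIdeal (hA : ∀ a ∈ A, a.degree = 2) : minGens (monIdeal K A) = A := by
  ext b
  simp only [minGens, monomial_mem_monIdeal_iff, Set.mem_ofPred_eq, Finset.mem_coe]
  constructor
  · intro h
    obtain ⟨a, ha, hab⟩ := h.1
    rwa [← h.eq_of_le ⟨a, ha, le_rfl⟩ hab]
  · intro hb
    refine ⟨⟨b, hb, le_rfl⟩, ?_⟩
    rintro a ⟨a', ha', haa'⟩ hab
    -- As both have degree two, the divisor `a'` of `b` equals `b`.
    obtain ⟨d, rfl⟩ := exists_add_of_le (haa'.trans hab)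
    have h1 := hA _ hb
    rw [map_add, hA _ ha', Nat.add_eq_left, Finsupp.degree_eq_zero_iff] at h1
    rwa [h1, add_zero]

variable [Fintype σ] [DecidableEq σ]

theorem taylorBetti_ne_zero_iff (hA : ∀ a ∈ A, a.degree = 2) (i j : ℕ) :
    taylorBetti (monIdeal K A) i j ≠ 0 ↔
      ∃ T ⊆ polarEdges A, T.card = i ∧ (T.sup id).card = j := by
  have hfin : {T ∈ taylorBasis (monIdeal K A) i | taylorDegree T = j}.Finite := by
    refine (A.powerset.finite_toSet).subset ?_
    rintro T ⟨⟨hT, -⟩, -⟩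
    rw [minGens_monIdeal hA] at hT
    simpa using hT
  rw [taylorBetti, Ne, Set.ncard_eq_zero hfin, ← Ne, ← Set.nonempty_iff_ne_empty]
  constructor
  · rintro ⟨T, ⟨hT, hTi⟩, hTj⟩
    rw [minGens_monIdeal hA, Finset.coe_subset] at hT
    refine ⟨T.image polarize, Finset.image_subset_image hT, ?_, ?_⟩
    · rw [Finset.card_image_of_injective _ polarize_injective, hTi]
    · rw [← polarize_sup, card_polarize]
      exact hTj
  · rintro ⟨T, hT, hTi, hTj⟩
    obtain ⟨T, hTA, rfl⟩ := Finset.subset_image_iff.1 hT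
    rw [Finset.card_image_of_injective _ polarize_injective] at hTi
    rw [← polarize_sup, card_polarize] at hTj
    refine ⟨T, ⟨?_, hTi⟩, hTj⟩
    rwa [minGens_monIdeal hA]

theorem maxSpan_le_taylorMaxShift (hA : ∀ a ∈ A, a.degree = 2) (i : ℕ) :
    maxSpan (polarEdges A) i ≤ taylorMaxShift (monIdeal K A) i := by
  refine Finset.sup_le fun T hT => ?_
  obtain ⟨hT, hTi⟩ := Finset.mem_powersetCard.1 hT
  refine le_csSup ⟨((polarEdges A).sup id).card, ?_⟩
    ((taylorBetti_ne_zero_iff hA i _).2 ⟨T, hT, hTi, rfl⟩)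
  intro j hj
  obtain ⟨T, hT, -, rfl⟩ := (taylorBetti_ne_zero_iff hA i j).1 hj
  exact Finset.card_le_card (Finset.sup_mono hT)

theorem taylorMinShift_le (hA : ∀ a ∈ A, a.degree = 2) {T : Finset (Finset (Σ _ : σ, ℕ))}
    (hT : T ⊆ polarEdges A) : taylorMinShift (monIdeal K A) T.card ≤ (T.sup id).card :=
  Nat.sInf_le ((taylorBetti_ne_zero_iff hA _ _).2 ⟨T, hT, rfl, rfl⟩)

end Taylor

section Hilbert

variable {σ K : Type*} [Field K] [Fintype σ] [DecidableEq σ] {A : Finset (σ →₀ ℕ)}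

open Classical in
/-- The exponent vectors of the monomials of degree `k` outside of the ideal generated by `A`. -/
noncomputable def standardMonomials (A : Finset (σ →₀ ℕ)) (k : ℕ) : Finset (σ →₀ ℕ) :=
  (Finset.univ.finsuppAntidiag k).filter fun b => ∀ a ∈ A, ¬ a ≤ b

theorem mem_standardMonomials {k : ℕ} {b : σ →₀ ℕ} :
    b ∈ standardMonomials A k ↔ b.degree = k ∧ ∀ a ∈ A, ¬ a ≤ b := by
  classical
  simp [standardMonomials, Finsupp.degree_eq_sum]

theorem hilbertFunction_monIdeal (k : ℕ) :
    hilbertFunction (monIdeal K A) k = (standardMonomials A k).card := by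
  set q := (Ideal.Quotient.mkₐ K (monIdeal K A)).toLinearMap with hq
  have hq0 : ∀ p, q p = 0 ↔ p ∈ monIdeal K A := fun p => Ideal.Quotient.eq_zero_iff_mem
  let f : standardMonomials A k → MvPolynomial σ K ⧸ monIdeal K A := fun b => q (monomial b.1 1)
  have hli : LinearIndependent K f := by
    rw [Fintype.linearIndependent_iff]
    intro g hg b
    have h1 : q (∑ b : standardMonomials A k, g b • monomial b.1 (1 : K)) = 0 := by
      rw [map_sum, ← hg]
      exact Finset.sum_congr rfl fun b _ => map_smul q _ _
    rw [hq0, mem_monIdeal_iff] at h1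
    by_contra hb
    obtain ⟨a, ha, hab⟩ := h1 b.1 (by
      rw [mem_support_iff, coeff_sum, Finset.sum_eq_single b]
      · simpa using hb
      · intro b' _ hb'
        rw [coeff_smul, coeff_monomial, if_neg fun h => hb' (Subtype.ext h), smul_zero]
      · simp)
    exact (mem_standardMonomials.1 b.2).2 a ha hab
  have hspan : (homogeneousSubmodule σ K k).map q = Submodule.span K (Set.range f) := by
    apply le_antisymm
    · rintro _ ⟨p, hp, rfl⟩
      rw [p.as_sum, map_sum]
      refine Submodule.sum_mem _ fun b hb => ?_
      by_cases hba : ∃ a ∈ A, a ≤ b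
      · rw [(hq0 _).2]
        · exact Submodule.zero_mem _
        · rw [← mul_one (coeff b p), ← smul_eq_mul, ← smul_monomial, smul_eq_C_mul]
          exact Ideal.mul_mem_left _ _ (monomial_mem_monIdeal_iff.2 hba)
      · have hb' : b ∈ standardMonomials A k := by
          refine mem_standardMonomials.2 ⟨?_, by simpa using hba⟩
          have := (mem_homogeneousSubmodule k p).1 hp (mem_support_iff.1 hb)
          rwa [Finsupp.degree_eq_weight_one]
        rw [← mul_one (coeff b p), ← smul_eq_mul, ← smul_monomial, map_smul]
        exact Submodule.smul_mem _ _ (Submodule.subset_span ⟨⟨b, hb'⟩, rfl⟩)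
    · rw [Submodule.span_le]
      rintro _ ⟨b, rfl⟩
      refine ⟨_, ?_, rfl⟩
      exact (mem_homogeneousSubmodule k _).2
        (isHomogeneous_monomial _ (mem_standardMonomials.1 b.2).1)
  rw [hilbertFunction, ← hq, hspan, finrank_span_eq_card hli, Fintype.card_coe]

/-- The power series `∑ X ^ m` over all `m` with `min m 2 = j`. -/
def truncSeries (j : ℕ) : PowerSeries ℤ :=
  PowerSeries.mk fun m => if min m 2 = j then 1 else 0

theorem truncSeries_mul {j : ℕ} (hj : j ≤ 2) :
    truncSeries j * (1 - PowerSeries.X) ^ (if j = 2 then 1 else 0) = PowerSeries.X ^ j := by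
  ext m
  rcases (by omega : j = 0 ∨ j = 1 ∨ j = 2) with rfl | rfl | rfl
  · simp only [truncSeries, OfNat.zero_ne_ofNat, ↓reduceIte, pow_zero, mul_one,
      PowerSeries.coeff_mk, PowerSeries.coeff_one]
    congr 1
    simp
  · simp only [truncSeries, OfNat.one_ne_ofNat, ↓reduceIte, pow_zero, mul_one, pow_one,
      PowerSeries.coeff_mk, PowerSeries.coeff_X]
    congr 1
    simp only [eq_iff_iff]
    omega
  · rw [if_pos rfl, pow_one, mul_sub, mul_one, map_sub, PowerSeries.coeff_X_pow]
    cases m with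
    | zero => simp [truncSeries]
    | succ m =>
      rw [PowerSeries.coeff_succ_mul_X]
      simp only [truncSeries, PowerSeries.coeff_mk]
      split_ifs <;> first | rfl | omega

/-- The vertices `⟨v, b v⟩` with `b v < 2`; for exponent vectors `b` with entries at most `2`,
these sets are the candidates for smallest vertex covers of a polarized graph. -/
def truncCover (b : σ → ℕ) : Finset (Σ _ : σ, ℕ) :=
  (Finset.univ.filter fun v => b v < 2).image fun v => ⟨v, b v⟩

theorem mem_truncCover {b : σ → ℕ} {v : σ} {k : ℕ} :
    (⟨v, k⟩ : Σ _ : σ, ℕ) ∈ truncCover b ↔ b v < 2 ∧ b v = k := by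
  simp only [truncCover, Finset.mem_image, Finset.mem_filter, Finset.mem_univ, true_and,
    Sigma.mk.injEq, heq_eq_eq]
  constructor
  · rintro ⟨w, hw, rfl, h⟩; exact ⟨hw, h⟩
  · rintro ⟨h1, h2⟩; exact ⟨v, h1, rfl, h2⟩

theorem card_truncCover {b : σ → ℕ} (hb : ∀ v, b v ≤ 2) :
    (truncCover b).card + (Finset.univ.filter fun v => b v = 2).card = Fintype.card σ := by
  have hinj : Function.Injective fun v => (⟨v, b v⟩ : Σ _ : σ, ℕ) := fun v w h =>
    congrArg Sigma.fst h
  rw [truncCover, Finset.card_image_of_injective _ hinj, ← Finset.card_union_of_disjoint]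
  · rw [← Finset.card_univ]
    congr 1
    ext v
    have := hb v
    simp only [Finset.mem_union, Finset.mem_filter, Finset.mem_univ, true_and, iff_true]
    omega
  · rw [Finset.disjoint_left]
    intro v hv hv'
    rw [Finset.mem_filter] at hv hv'
    omega

theorem isCover_truncCover_iff (hA : ∀ a ∈ A, a.degree = 2) (b : σ →₀ ℕ) :
    IsCover (polarEdges A) (truncCover fun v => min (b v) 2) ↔ ∀ a ∈ A, ¬ a ≤ b := by
  rw [isCover_polarEdges_iff]
  refine forall₂_congr fun a ha => ?_
  simp only [mem_truncCover, Finsupp.le_def, not_forall, not_le]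
  constructor
  · rintro ⟨v, k, h1, h2, h3⟩
    exact ⟨v, by omega⟩
  · rintro ⟨v, hv⟩
    have := apply_le_two hA ha v
    exact ⟨v, _, by omega, by omega, rfl⟩

open Classical in
/-- The exponent vectors with entries at most `2` of monomials outside of the ideal generated by
`A`. Whether a monomial lies in the ideal only depends on its exponents truncated at `2`. -/
noncomputable def truncStandard (A : Finset (σ →₀ ℕ)) : Finset (σ → ℕ) :=
  (Fintype.piFinset fun _ => Finset.range 3).filter fun b => IsCover (polarEdges A) (truncCover b)

theorem mem_truncStandard {b : σ → ℕ} :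
    b ∈ truncStandard A ↔ (∀ v, b v ≤ 2) ∧ IsCover (polarEdges A) (truncCover b) := by
  simp [truncStandard, Fintype.mem_piFinset, Nat.lt_succ_iff]

theorem hilbertSeries_monIdeal (hA : ∀ a ∈ A, a.degree = 2) :
    hilbertSeries (monIdeal K A) = ∑ b ∈ truncStandard A, ∏ v, truncSeries (b v) := by
  ext k
  rw [hilbertSeries, PowerSeries.coeff_mk, hilbertFunction_monIdeal, map_sum]
  have hcoeff : ∀ b : σ → ℕ, PowerSeries.coeff k (∏ v, truncSeries (b v)) =
      ∑ a ∈ Finset.univ.finsuppAntidiag k, if (fun v => min (a v) 2) = b then (1 : ℤ) else 0 := by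
    intro b
    rw [PowerSeries.coeff_prod]
    refine Finset.sum_congr rfl fun a _ => ?_
    simp only [truncSeries, PowerSeries.coeff_mk]
    rw [Finset.prod_ite_zero, Finset.prod_const_one]
    congr 1
    simp [funext_iff]
  rw [Finset.sum_congr rfl fun b _ => hcoeff b, Finset.sum_comm]
  simp only [Finset.sum_ite_eq]
  rw [Finset.sum_boole]
  congr 2
  ext a
  simp only [Finset.mem_filter, mem_truncStandard, isCover_truncCover_iff hA, standardMonomials]
  refine and_congr_right fun _ => ?_
  simp

theorem truncCover_mem_minCovers_iff {b : σ → ℕ} (hb : b ∈ truncStandard A) :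
    truncCover b ∈ minCovers (polarEdges A) ↔
      Fintype.card σ - coverNumber (polarEdges A) -
        (Finset.univ.filter fun v => b v = 2).card = 0 := by
  obtain ⟨hb, hcov⟩ := mem_truncStandard.1 hb
  have h1 := card_truncCover hb
  have h2 := coverNumber_le hcov
  rw [mem_minCovers, and_iff_right hcov]
  omega

/-- A smallest cover `C` contains at most one of `⟨v, 0⟩` and `⟨v, 1⟩`, as each edge through the
latter contains the former as well. So it is determined by the least `k` with `⟨v, k⟩ ∈ C`. -/
theorem card_filter_truncStandard (hA : ∀ a ∈ A, a.degree = 2) :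
    ((truncStandard A).filter fun b => truncCover b ∈ minCovers (polarEdges A)).card =
      (minCovers (polarEdges A)).card := by
  refine Finset.card_bij (fun b _ => truncCover b) ?_ ?_ ?_
  · intro b hb
    exact (Finset.mem_filter.1 hb).2
  · intro b hb b' hb' h
    have h1 := (mem_truncStandard.1 (Finset.mem_filter.1 hb).1).1
    have h2 := (mem_truncStandard.1 (Finset.mem_filter.1 hb').1).1
    funext v
    have e1 := h1 v
    have e2 := h2 v
    by_cases hv : b v < 2
    · have := mem_truncCover.1 (h ▸ mem_truncCover.2 ⟨hv, rfl⟩)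
      exact this.2.symm
    · by_cases hv' : b' v < 2
      · have := mem_truncCover.1 (h.symm ▸ mem_truncCover.2 ⟨hv', rfl⟩)
        exact this.2
      · omega
  · intro C hC
    obtain ⟨hcov, hcard⟩ := mem_minCovers.1 hC
    let b : σ → ℕ := fun v =>
      if (⟨v, 0⟩ : Σ _ : σ, ℕ) ∈ C then 0 else if (⟨v, 1⟩ : Σ _ : σ, ℕ) ∈ C then 1 else 2
    have hb : ∀ v, b v ≤ 2 := by
      intro v
      simp only [b]
      split_ifs <;> omega
    have hsub : truncCover b ⊆ C := by
      rintro ⟨v, k⟩ hvk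
      obtain ⟨h1, rfl⟩ := mem_truncCover.1 hvk
      simp only [b] at h1 ⊢
      split_ifs at h1 ⊢ with h2 h3
      · exact h2
      · exact h3
      · exact absurd h1 (lt_irrefl _)
    have hbcov : IsCover (polarEdges A) (truncCover b) := by
      rw [isCover_polarEdges_iff] at hcov ⊢
      intro a ha
      obtain ⟨v, k, hk, hkC⟩ := hcov a ha
      have h2 := apply_le_two hA ha v
      have h3 : b v ≤ k := by
        simp only [b]
        rcases (by omega : k = 0 ∨ k = 1) with rfl | rfl
        · rw [if_pos hkC]
        · split_ifs <;> omega
      exact ⟨v, b v, by omega, mem_truncCover.2 ⟨by omega, rfl⟩⟩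
    have heq : truncCover b = C :=
      Finset.eq_of_subset_of_card_le hsub (hcard.trans_le (coverNumber_le hbcov))
    exact ⟨b, Finset.mem_filter.2 ⟨mem_truncStandard.2 ⟨hb, hbcov⟩, heq.symm ▸ hC⟩, heq⟩

theorem hasMultiplicity_monIdeal (hA : ∀ a ∈ A, a.degree = 2) :
    HasMultiplicity (monIdeal K A) (minCovers (polarEdges A)).card := by
  obtain ⟨Z, hZ, hZc⟩ := exists_isVarCover hA
  set d := Fintype.card σ - coverNumber (polarEdges A) with hd
  set t : (σ → ℕ) → ℕ := fun b => (Finset.univ.filter fun v => b v = 2).card with ht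
  refine ⟨d, ∑ b ∈ truncStandard A,
    (∏ v, Polynomial.X ^ b v) * (1 - Polynomial.X) ^ (d - t b), ?_, ?_, ?_⟩
  · exact ringKrullDim_quotient_monIdeal (fun Z hZ => coverNumber_le_card_of_isVarCover hZ) hZ hZc
  · rw [hilbertSeries_monIdeal hA, Finset.sum_mul, ← Polynomial.coeToPowerSeries.ringHom_apply,
      map_sum]
    refine Finset.sum_congr rfl fun b hb => ?_
    obtain ⟨hb, hcov⟩ := mem_truncStandard.1 hb
    have h1 := card_truncCover hb
    have h2 := coverNumber_le hcov
    have htd : t b + (d - t b) = d := by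
      have : t b = (Finset.univ.filter fun v => b v = 2).card := rfl
      omega
    have htb : (1 - PowerSeries.X : PowerSeries ℤ) ^ t b =
        ∏ v, (1 - PowerSeries.X) ^ (if b v = 2 then 1 else 0) := by
      rw [Finset.prod_pow_eq_pow_sum, Finset.sum_boole, Nat.cast_id]
    rw [← htd, pow_add, ← mul_assoc, htb, ← Finset.prod_mul_distrib,
      Finset.prod_congr rfl fun v _ => truncSeries_mul (hb v), htd,
      map_mul, map_prod, map_pow, map_sub, map_one]
    simp
  · rw [Polynomial.eval_finsetSum, ← card_filter_truncStandard hA, Finset.card_filter]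
    push_cast
    refine Finset.sum_congr rfl fun b hb => ?_
    rw [if_congr (truncCover_mem_minCovers_iff hb) rfl rfl]
    simp only [Polynomial.eval_mul, Polynomial.eval_prod, Polynomial.eval_pow, Polynomial.eval_X,
      one_pow, Finset.prod_const_one, one_mul, Polynomial.eval_sub, Polynomial.eval_one, sub_self,
      zero_pow_eq]
    rfl

end Hilbert

/-! ### Cohen-Macaulay monomial ideals -/

section Localization

variable {S R : Type*} [CommRing S] [CommRing R] [Algebra S R]

open scoped Pointwise in
theorem hasDepth_of_isWeaklyRegular {𝔪 : Ideal S} (θ : List S) (hθ : ∀ f ∈ θ, f ∈ 𝔪) (J : Ideal S)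
    (h : RingTheory.Sequence.IsWeaklyRegular (S ⧸ J) θ) : HasDepth 𝔪 θ.length J := by
  induction θ generalizing J with
  | nil => trivial
  | cons f θ ih =>
    rw [RingTheory.Sequence.isWeaklyRegular_cons_iff] at h
    refine ⟨f, hθ f (by simp), ?_, ih (fun g hg => hθ g (by simp [hg])) _ ?_⟩
    · intro x hx
      rw [← Ideal.Quotient.eq_zero_iff_mem]
      apply h.1
      change f • Ideal.Quotient.mk J x = f • (0 : S ⧸ J)
      rw [smul_zero, Algebra.smul_def, Ideal.Quotient.algebraMap_eq, ← map_mul]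
      exact Ideal.Quotient.eq_zero_iff_mem.2 hx
    · have heq : f • (⊤ : Submodule S (S ⧸ J)) =
          Submodule.map J.mkQ (Ideal.span {f}) := by
        rw [← Submodule.ideal_span_singleton_smul, ← Submodule.range_mkQ J, ← Submodule.map_top,
          ← Submodule.map_smul'', smul_eq_mul, Ideal.mul_top]
      exact (((Submodule.quotEquivOfEq _ _ heq).trans
        (Submodule.quotientQuotientEquivQuotientSup J (Ideal.span {f}))).isWeaklyRegular_congr θ).1
          h.2

theorem mem_map_localization_iff (M : Submonoid S) [IsLocalization M R] {J : Ideal S} {x : S} :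
    algebraMap S R x ∈ J.map (algebraMap S R) ↔ ∃ u ∈ M, u * x ∈ J := by
  rw [IsLocalization.mem_map_algebraMap_iff M R]
  constructor
  · rintro ⟨⟨j, u⟩, h⟩
    rw [← map_mul] at h
    obtain ⟨w, hw⟩ := IsLocalization.exists_of_eq (M := M) h
    refine ⟨w * u, M.mul_mem w.2 u.2, ?_⟩
    have := J.mul_mem_left (w : S) j.2
    rw [← hw] at this
    convert this using 1
    ring
  · rintro ⟨u, hu, h⟩
    exact ⟨⟨⟨_, h⟩, ⟨u, hu⟩⟩, by simp [mul_comm]⟩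

theorem IsRegularMod.map (M : Submonoid S) [IsLocalization M R] {f : S} {J : Ideal S}
    (h : IsRegularMod f J) : IsRegularMod (algebraMap S R f) (J.map (algebraMap S R)) := by
  intro x hx
  obtain ⟨⟨s, t⟩, hst⟩ := IsLocalization.surj M x
  have h1 : algebraMap S R (f * s) ∈ J.map (algebraMap S R) := by
    rw [map_mul, ← hst, ← mul_assoc]
    exact Ideal.mul_mem_right _ _ hx
  obtain ⟨u, hu, hus⟩ := (mem_map_localization_iff M).1 h1
  have h2 : algebraMap S R s ∈ J.map (algebraMap S R) :=
    (mem_map_localization_iff M).2 ⟨u, hu, h _ (by convert hus using 1; ring)⟩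
  rw [← hst] at h2
  exact (Ideal.mul_unit_mem_iff_mem _ (IsLocalization.map_units R t)).1 h2

theorem HasDepth.map (𝔪 : Ideal S) [𝔪.IsPrime] [IsLocalization.AtPrime R 𝔪] [IsLocalRing R]
    {r : ℕ} {J : Ideal S} (h : HasDepth 𝔪 r J) :
    HasDepth (IsLocalRing.maximalIdeal R) r (J.map (algebraMap S R)) := by
  induction r generalizing J with
  | zero => trivial
  | succ r ih =>
    obtain ⟨f, hf, hfJ, hd⟩ := h
    refine ⟨algebraMap S R f, (IsLocalization.AtPrime.to_map_mem_maximal_iff R 𝔪 f _).2 hf,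
      hfJ.map 𝔪.primeCompl, ?_⟩
    have := ih hd
    rwa [Ideal.map_sup, Ideal.map_span, Set.image_singleton] at this

theorem coheight_le_coheight_comap (M : Submonoid S) [IsLocalization M R] (p : PrimeSpectrum R) :
    Order.coheight p ≤ Order.coheight (PrimeSpectrum.comap (algebraMap S R) p) := by
  apply Order.coheight_le_coheight_apply_of_strictMono
  have hmono : Monotone (PrimeSpectrum.comap (algebraMap S R)) := fun p q h =>
    Ideal.comap_mono h
  exact hmono.strictMono_of_injective (PrimeSpectrum.localization_comap_injective R M)

end Localization

section CohenMacaulay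

variable {σ K : Type*} [Field K] {A : Finset (σ →₀ ℕ)}

theorem exists_eq_single_add {g : σ →₀ ℕ} {v : σ} (hv : v ∈ g.support) :
    ∃ h, g = Finsupp.single v 1 + h := by
  apply exists_add_of_le
  rw [Finsupp.single_le_iff]
  exact Nat.one_le_iff_ne_zero.2 (Finsupp.mem_support_iff.1 hv)

theorem exists_eq_single_add_single {g : σ →₀ ℕ} (hg : g.degree = 2) {v : σ}
    (hv : v ∈ g.support) : ∃ w, g = Finsupp.single v 1 + Finsupp.single w 1 := by
  obtain ⟨h, rfl⟩ := exists_eq_single_add hv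
  rw [map_add, Finsupp.degree_single] at hg
  obtain ⟨w, hw⟩ : h.support.Nonempty := by
    rw [Finsupp.support_nonempty_iff]
    rintro rfl
    simp at hg
  obtain ⟨h', rfl⟩ := exists_eq_single_add hw
  rw [map_add, Finsupp.degree_single] at hg
  have : h' = 0 := (Finsupp.degree_eq_zero_iff _).1 (by omega)
  exact ⟨w, by rw [this, add_zero]⟩

variable [DecidableEq σ]

/-- The exchange of `⟨v, 1⟩` for `⟨v, 0⟩`. -/
def lower (v : σ) (C : Finset (Σ _ : σ, ℕ)) : Finset (Σ _ : σ, ℕ) :=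
  insert ⟨v, 0⟩ (C.erase ⟨v, 1⟩)

theorem card_union_lower_le (C : Finset (Σ _ : σ, ℕ)) (v : σ) :
    (C ∪ lower v C).card ≤ C.card + 1 := by
  rw [lower, Finset.union_insert, Finset.union_eq_left.2 (Finset.erase_subset _ _)]
  exact Finset.card_insert_le _ _

/-- The cover by the vertices `⟨v, 0⟩` obtained by applying all the exchanges `lower v`. -/
def base (C : Finset (Σ _ : σ, ℕ)) : Finset (Σ _ : σ, ℕ) :=
  C.image fun x => ⟨x.1, 0⟩

variable (K) in
/-- The irreducible monomial ideal attached to a vertex set of the polarization: it is generated by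
the powers `X v ^ (k + 1)` with `⟨v, k⟩ ∈ C`. -/
noncomputable def component (C : Finset (Σ _ : σ, ℕ)) : Ideal (MvPolynomial σ K) :=
  monIdeal K (C.image fun x => Finsupp.single x.1 (x.2 + 1))

theorem mem_component_iff {C : Finset (Σ _ : σ, ℕ)} {f : MvPolynomial σ K} :
    f ∈ component K C ↔ ∀ b ∈ f.support, ∃ x ∈ C, x.2 < b x.1 := by
  simp only [component, mem_monIdeal_iff, Finset.exists_mem_image, Finsupp.single_le_iff,
    Nat.succ_le_iff]

theorem X_mem_of_component_le {C : Finset (Σ _ : σ, ℕ)} {Q : Ideal (MvPolynomial σ K)} [Q.IsPrime]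
    (h : component K C ≤ Q) {x : Σ _ : σ, ℕ} (hx : x ∈ C) : (X x.1 : MvPolynomial σ K) ∈ Q := by
  obtain ⟨v, hv, hvQ⟩ := monomial_mem_prime_iff.1 (h (monomial_mem_monIdeal
    (Finset.mem_image_of_mem (fun x : Σ _ : σ, ℕ => Finsupp.single x.1 (x.2 + 1)) hx)))
  obtain rfl := Finset.mem_singleton.1 (Finsupp.support_single_subset hv)
  exact hvQ

theorem component_le_varIdeal (C : Finset (Σ _ : σ, ℕ)) :
    component K C ≤ varIdeal K (C.image Sigma.fst) := by
  refine monIdeal_le_varIdeal fun a ha => ?_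
  obtain ⟨x, hx, rfl⟩ := Finset.mem_image.1 ha
  exact ⟨x.1, by simp, Finset.mem_image_of_mem _ hx⟩

variable [Fintype σ]

theorem mem_varIdeal_univ {f : MvPolynomial σ K} :
    f ∈ varIdeal K (Finset.univ : Finset σ) ↔ coeff 0 f = 0 := by
  have : (fun v : σ => if v ∈ Finset.univ then 0 else (X v : MvPolynomial σ K)) = 0 := by
    ext; simp
  rw [varIdeal, RingHom.mem_ker, this, aeval_zero, algebraMap_eq, C_eq_zero, constantCoeff_eq]

variable (σ K) in
/-- The localization of the polynomial ring at the ideal generated by all the variables. -/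
abbrev LocalizedAtOrigin : Type _ :=
  Localization.AtPrime (varIdeal K (Finset.univ : Finset σ))

/-- The extension of an ideal to the localization at the ideal generated by all the variables. -/
noncomputable abbrev localize (J : Ideal (MvPolynomial σ K)) : Ideal (LocalizedAtOrigin σ K) :=
  J.map (algebraMap _ _)

theorem hasDepth_of_isCohenMacaulayQuotient (hA : ∀ a ∈ A, a.degree = 2)
    (h : IsCohenMacaulayQuotient (monIdeal K A)) :
    HasDepth (IsLocalRing.maximalIdeal (LocalizedAtOrigin σ K))
      (Fintype.card σ - coverNumber (polarEdges A)) (localize (monIdeal K A)) := by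
  obtain ⟨θ, hθ, hreg, hdim⟩ := h
  obtain ⟨Z, hZ, hZc⟩ := exists_isVarCover hA
  rw [ringKrullDim_quotient_monIdeal (fun Z hZ => coverNumber_le_card_of_isVarCover hZ) hZ hZc]
    at hdim
  have hlen : Fintype.card σ - coverNumber (polarEdges A) = θ.length := by exact_mod_cast hdim
  rw [hlen]
  refine HasDepth.map (varIdeal K Finset.univ)
    (hasDepth_of_isWeaklyRegular θ (fun f hf => ?_) _ hreg.1)
  obtain ⟨k, hk, hfk⟩ := hθ f hf
  rw [mem_varIdeal_univ]
  refine hfk.coeff_eq_zero ?_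
  simpa using hk.ne

theorem monomial_mem_localize_iff {a : σ →₀ ℕ} :
    algebraMap _ (LocalizedAtOrigin σ K) (monomial a (1 : K)) ∈ localize (monIdeal K A) ↔
      ∃ g ∈ A, g ≤ a := by
  rw [mem_map_localization_iff (varIdeal K (Finset.univ : Finset σ)).primeCompl]
  constructor
  · rintro ⟨u, hu, hua⟩
    rw [mem_monIdeal_iff] at hua
    refine hua a ?_
    have := coeff_mul_monomial 0 a (1 : K) u
    rw [zero_add, mul_one] at this
    rw [mem_support_iff, this]
    exact fun h0 => hu (mem_varIdeal_univ.2 h0)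
  · intro h
    exact ⟨1, Submonoid.one_mem _, by rw [one_mul]; exact monomial_mem_monIdeal_iff.2 h⟩

/-- Unmixedness: if `R / I` is Cohen-Macaulay, each monomial `x ^ a` outside of `I` avoids the
primary component of `I` given by some smallest cover `D`. The variables in an associated prime
containing `I : x ^ a` form a smallest cover `Z`, and `D` is the lift of `Z` to the polarization
that avoids the polarization of `x ^ a`. -/
theorem exists_mem_minCovers_forall_le (hA : ∀ a ∈ A, a.degree = 2)
    (h : IsCohenMacaulayQuotient (monIdeal K A)) {a : σ →₀ ℕ} (ha : ∀ g ∈ A, ¬ g ≤ a) :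
    ∃ D ∈ minCovers (polarEdges A), ∀ v k, (⟨v, k⟩ : Σ _ : σ, ℕ) ∈ D → a v ≤ k := by
  classical
  set ι := algebraMap (MvPolynomial σ K) (LocalizedAtOrigin σ K) with hι
  obtain ⟨P, hP, hPle⟩ := exists_isAssociatedPrime_ge
    (J := localize (monIdeal K A)) (x := ι (monomial a (1 : K))) (by
      rw [monomial_mem_localize_iff]
      push Not
      exact ha)
  let p : PrimeSpectrum (LocalizedAtOrigin σ K) := ⟨P, hP.isPrime⟩
  let q := PrimeSpectrum.comap ι p
  have hq : ∀ m : σ →₀ ℕ, (∃ g ∈ A, g ≤ m + a) → monomial m (1 : K) ∈ q.asIdeal := by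
    intro m hm
    refine hPle _ ?_
    rw [← map_mul, monomial_mul, one_mul, monomial_mem_localize_iff]
    exact hm
  have hqX : ∀ v, (∃ g ∈ A, g ≤ Finsupp.single v 1 + a) → (X v : MvPolynomial σ K) ∈ q.asIdeal :=
    fun v => hq _
  set Z := Finset.univ.filter fun v => (X v : MvPolynomial σ K) ∈ q.asIdeal with hZdef
  have hZ : IsVarCover A Z := by
    refine isVarCover_of_monIdeal_le ?_
    rw [monIdeal, Ideal.span_le]
    rintro _ ⟨g, hg, rfl⟩
    exact hq g ⟨g, hg, le_self_add⟩
  have hZc : Z.card ≤ coverNumber (polarEdges A) := by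
    obtain ⟨Z', -, hZ'⟩ := exists_isVarCover hA
    have hle : coverNumber (polarEdges A) ≤ Fintype.card σ := hZ' ▸ Finset.card_le_univ Z'
    have h1 := (hasDepth_of_isCohenMacaulayQuotient hA h).le_coheight p hP
    have h2 := coheight_le_coheight_comap (varIdeal K (Finset.univ : Finset σ)).primeCompl p
    have h3 := coheight_add_card_le (p := q) (Z := Z) (by simp [hZdef])
    have h4 : ((Fintype.card σ - coverNumber (polarEdges A) : ℕ) + Z.card : ℕ∞) ≤
        Fintype.card σ := (add_le_add_left (h1.trans h2) _).trans h3
    have h5 : Fintype.card σ - coverNumber (polarEdges A) + Z.card ≤ Fintype.card σ := by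
      exact_mod_cast h4
    omega
  -- As `Z` is a smallest cover, `v ∈ Z` has a private generator `g`; as `x ^ a ∉ I`, if `v` occurs
  -- in `x ^ a` then `g` is the square of `v`, and so `a v = 1`.
  have hle1 : ∀ v ∈ Z, a v ≤ 1 := by
    intro v hv
    by_contra! hav
    have hnot : ¬ IsVarCover A (Z.erase v) := by
      intro hcov
      have h1 := coverNumber_le_card_of_isVarCover hcov
      have h2 := Finset.card_erase_lt_of_mem hv
      omega
    unfold IsVarCover at hnot
    push Not at hnot
    obtain ⟨g, hg, hgZ⟩ := hnot
    obtain ⟨u, hu, huZ⟩ := hZ g hg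
    obtain rfl : u = v := by
      by_contra hne
      exact hgZ u hu (Finset.mem_erase.2 ⟨hne, huZ⟩)
    obtain ⟨w, rfl⟩ := exists_eq_single_add_single (hA g hg) hu
    by_cases hwv : w = u
    · subst hwv
      apply ha _ hg
      rw [← Finsupp.single_add, Finsupp.single_le_iff]
      exact hav
    · refine hgZ w (by simp) (Finset.mem_erase.2 ⟨hwv, ?_⟩)
      rw [hZdef, Finset.mem_filter]
      refine ⟨Finset.mem_univ _, hqX w ⟨_, hg, ?_⟩⟩
      rw [add_comm]
      gcongr
      rw [Finsupp.single_le_iff]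
      omega
  let f : σ → Σ _ : σ, ℕ := fun v => ⟨v, if a v = 0 then 0 else 1⟩
  have hmem : ∀ v k, (⟨v, k⟩ : Σ _ : σ, ℕ) ∈ Z.image f ↔
      v ∈ Z ∧ (if a v = 0 then 0 else 1) = k := by
    intro v k
    simp only [f, Finset.mem_image, Sigma.mk.injEq, heq_eq_eq]
    constructor
    · rintro ⟨u, hu, rfl, hk⟩
      exact ⟨hu, hk⟩
    · rintro ⟨hu, hk⟩
      exact ⟨v, hu, rfl, hk⟩
  have hcov : IsCover (polarEdges A) (Z.image f) := by
    rw [isCover_polarEdges_iff]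
    intro g hg
    obtain ⟨v, hv, hvZ⟩ := hZ g hg
    by_cases hav : a v = 0
    · exact ⟨v, 0, Nat.pos_of_ne_zero (Finsupp.mem_support_iff.1 hv),
        (hmem v 0).2 ⟨hvZ, if_pos hav⟩⟩
    · obtain ⟨w, rfl⟩ := exists_eq_single_add_single (hA g hg) hv
      by_cases hwv : w = v
      · subst hwv
        exact ⟨w, 1, by simp, (hmem w 1).2 ⟨hvZ, if_neg hav⟩⟩
      · have hwZ : w ∈ Z := by
          rw [hZdef, Finset.mem_filter]
          refine ⟨Finset.mem_univ _, hqX w ⟨_, hg, ?_⟩⟩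
          rw [add_comm]
          gcongr
          rw [Finsupp.single_le_iff]
          omega
        have haw : a w = 0 := by
          by_contra haw
          apply ha _ hg
          intro u
          rw [Finsupp.add_apply, Finsupp.single_apply, Finsupp.single_apply]
          split_ifs with h1 h2 h2
          · exact absurd (h2.trans h1.symm) hwv
          · subst h1; omega
          · subst h2; omega
          · omega
        exact ⟨w, 0, by simp, (hmem w 0).2 ⟨hwZ, if_pos haw⟩⟩
  refine ⟨Z.image f, mem_minCovers.2 ⟨hcov, le_antisymm (Finset.card_image_le.trans hZc)
    (coverNumber_le hcov)⟩, fun v k hvk => ?_⟩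
  obtain ⟨hvZ, rfl⟩ := (hmem v k).1 hvk
  have := hle1 v hvZ
  split_ifs <;> omega

theorem lower_mem_minCovers {C : Finset (Σ _ : σ, ℕ)} (hC : C ∈ minCovers (polarEdges A)) {v : σ}
    (hv : (⟨v, 1⟩ : Σ _ : σ, ℕ) ∈ C) : lower v C ∈ minCovers (polarEdges A) := by
  obtain ⟨h, hc⟩ := mem_minCovers.1 hC
  have hcov : IsCover (polarEdges A) (lower v C) := by
    rw [isCover_polarEdges_iff] at h ⊢
    intro g hg
    obtain ⟨u, k, hk, hu⟩ := h g hg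
    by_cases huv : (⟨u, k⟩ : Σ _ : σ, ℕ) = ⟨v, 1⟩
    · obtain ⟨rfl, huv⟩ := Sigma.mk.inj_iff.1 huv
      exact ⟨u, 0, by omega, Finset.mem_insert_self _ _⟩
    · exact ⟨u, k, hk, Finset.mem_insert_of_mem (Finset.mem_erase.2 ⟨huv, hu⟩)⟩
  refine mem_minCovers.2 ⟨hcov, le_antisymm ?_ (coverNumber_le hcov)⟩
  refine (Finset.card_insert_le _ _).trans ?_
  rw [Finset.card_erase_add_one hv, hc]

theorem snd_le_one {C : Finset (Σ _ : σ, ℕ)} (hA : ∀ a ∈ A, a.degree = 2)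
    (hC : C ∈ minCovers (polarEdges A)) {x : Σ _ : σ, ℕ} (hx : x ∈ C) : x.2 ≤ 1 := by
  obtain ⟨e, he, hxe⟩ := Finset.mem_sup.1 (subset_support_of_mem_minCovers hC hx)
  obtain ⟨g, hg, rfl⟩ := Finset.mem_image.1 he
  have h1 := mem_polarize.1 hxe
  have h2 := apply_le_two hA hg x.1
  omega

theorem exists_minCover_notMem (hA : ∀ a ∈ A, a.degree = 2)
    (h : IsCohenMacaulayQuotient (monIdeal K A)) :
    ∀ x ∈ (polarEdges A).sup id, ∃ C ∈ minCovers (polarEdges A), x ∉ C := by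
  rintro ⟨v, k⟩ hx
  obtain ⟨e, he, hxe⟩ := Finset.mem_sup.1 hx
  obtain ⟨g, hg, rfl⟩ := Finset.mem_image.1 he
  have h1 : k < g v := mem_polarize.1 hxe
  have h2 := apply_le_two hA hg v
  rcases (by omega : k = 0 ∨ k = 1) with rfl | rfl
  · obtain ⟨D, hD, hDa⟩ := exists_mem_minCovers_forall_le hA h (a := Finsupp.single v 1) (by
      intro g hg hle
      have := Finsupp.degree_mono hle
      rw [hA g hg, Finsupp.degree_single] at this
      omega)
    refine ⟨D, hD, fun hmem => ?_⟩
    have := hDa v 0 hmem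
    simp at this
  · obtain ⟨C, hC⟩ := minCovers_nonempty (nonempty_of_mem_polarEdges hA)
    by_cases hv : (⟨v, 1⟩ : Σ _ : σ, ℕ) ∈ C
    · exact ⟨_, lower_mem_minCovers hC hv, by simp [lower]⟩
    · exact ⟨C, hC, hv⟩

theorem base_mem_of_lower_mem (hA : ∀ a ∈ A, a.degree = 2) {𝒳 : Finset (Finset (Σ _ : σ, ℕ))}
    (h𝒳 : 𝒳 ⊆ minCovers (polarEdges A))
    (hlow : ∀ C ∈ 𝒳, ∀ v, (⟨v, 1⟩ : Σ _ : σ, ℕ) ∈ C → lower v C ∈ 𝒳)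
    {C : Finset (Σ _ : σ, ℕ)} (hC : C ∈ 𝒳) : base C ∈ 𝒳 := by
  generalize hk : (C.filter fun x => x.2 = 1).card = k
  induction k generalizing C with
  | zero =>
    have hC0 : ∀ x ∈ C, x.2 = 0 := by
      intro x hx
      have h1 := snd_le_one hA (h𝒳 hC) hx
      have h2 : x.2 ≠ 1 := (Finset.filter_eq_empty_iff.1 (Finset.card_eq_zero.1 hk)) hx
      omega
    have : base C = C := by
      have : Set.EqOn (fun x : Σ _ : σ, ℕ => (⟨x.1, 0⟩ : Σ _ : σ, ℕ)) id C := by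
        rintro ⟨v, k⟩ hx
        obtain rfl : k = 0 := hC0 _ hx
        rfl
      rw [base, Finset.image_congr this, Finset.image_id]
    rwa [this]
  | succ k ih =>
    obtain ⟨⟨v, j⟩, hx⟩ := Finset.card_pos.1 (by omega : 0 < (C.filter fun x => x.2 = 1).card)
    obtain ⟨hxC, hj⟩ := Finset.mem_filter.1 hx
    obtain rfl : j = 1 := hj
    have h1 := ih (hlow C hC v hxC) (by
      have : (lower v C).filter (fun x => x.2 = 1) = (C.filter fun x => x.2 = 1).erase ⟨v, 1⟩ := by
        rw [lower, Finset.filter_insert, if_neg (by simp), Finset.filter_erase]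
      rw [this, Finset.card_erase_of_mem hx, hk, Nat.add_sub_cancel])
    have h2 : base (lower v C) = base C := by
      rw [base, lower, Finset.image_insert, base]
      conv_rhs => rw [← Finset.insert_erase hxC, Finset.image_insert]
    rwa [h2] at h1

theorem monIdeal_eq_inf_component (hA : ∀ a ∈ A, a.degree = 2)
    (h : IsCohenMacaulayQuotient (monIdeal K A)) :
    monIdeal K A = (minCovers (polarEdges A)).inf (component K) := by
  apply le_antisymm
  · refine Finset.le_inf fun C hC f hf => mem_component_iff.2 fun b hb => ?_
    obtain ⟨g, hg, hgb⟩ := mem_monIdeal_iff.1 hf b hb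
    obtain ⟨v, k, hk, hkC⟩ := isCover_polarEdges_iff.1 (mem_minCovers.1 hC).1 g hg
    exact ⟨⟨v, k⟩, hkC, hk.trans_le (hgb v)⟩
  · intro f hf
    rw [mem_monIdeal_iff]
    intro b hb
    by_contra! hcon
    obtain ⟨D, hD, hDb⟩ := exists_mem_minCovers_forall_le hA h hcon
    obtain ⟨⟨v, k⟩, hx, hlt⟩ := mem_component_iff.1 (Finset.inf_le (f := component K) hD hf) b hb
    exact (hDb v k hx).not_gt hlt

theorem exists_base_subset_base {𝒜 ℬ : Finset (Finset (Σ _ : σ, ℕ))} (hℬ : ℬ.Nonempty)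
    (h : localize (𝒜.inf (component K)) ≤ localize (ℬ.inf (component K))) :
    ∃ C ∈ 𝒜, ∃ D ∈ ℬ, base C ⊆ base D := by
  obtain ⟨D, hD⟩ := hℬ
  set P := varIdeal K (D.image Sigma.fst) with hP
  have hdis : Disjoint ((varIdeal K (Finset.univ : Finset σ)).primeCompl : Set (MvPolynomial σ K))
      (P : Set (MvPolynomial σ K)) := by
    rw [Set.disjoint_left]
    intro f hf hfP
    exact hf (varIdeal_le (fun v _ => X_mem_varIdeal.2 (Finset.mem_univ v)) hfP)
  have h1 : 𝒜.inf (component K) ≤ P := by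
    rw [← IsLocalization.under_map_of_isPrime_disjoint
      (varIdeal K (Finset.univ : Finset σ)).primeCompl (LocalizedAtOrigin σ K)
      (inferInstance : P.IsPrime) hdis]
    refine Ideal.map_le_iff_le_comap.1 (h.trans (Ideal.map_mono ?_))
    exact (Finset.inf_le hD).trans (component_le_varIdeal D)
  obtain ⟨C, hC, hCP⟩ := (Ideal.IsPrime.inf_le' inferInstance).1 h1
  refine ⟨C, hC, D, hD, ?_⟩
  intro x hx
  obtain ⟨y, hy, rfl⟩ := Finset.mem_image.1 hx
  obtain ⟨z, hz, hzy⟩ := Finset.mem_image.1 (X_mem_varIdeal.1 (X_mem_of_component_le hCP hy))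
  exact Finset.mem_image.2 ⟨z, hz, by rw [hzy]⟩

/-- The smallest covers of the polarization of a Cohen-Macaulay ideal are connected in codimension
one. Otherwise both parts `𝒜` and `ℬ` of a separation are closed under the exchanges `lower v`, and
the intersections of the components over `𝒜` and over `ℬ` contradict Hartshorne's theorem. -/
theorem connectedInCodimOne_minCovers (hA : ∀ a ∈ A, a.degree = 2)
    (h : IsCohenMacaulayQuotient (monIdeal K A)) :
    ConnectedInCodimOne (minCovers (polarEdges A)) (coverNumber (polarEdges A)) := by
  intro 𝒜 h𝒜 hne hne'
  by_contra! hcon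
  set ℬ := minCovers (polarEdges A) \ 𝒜 with hℬ
  have hℬne : ℬ.Nonempty := by
    rw [Finset.sdiff_nonempty]
    exact fun hsub => hne' (Finset.Subset.antisymm h𝒜 hsub)
  have hsep : ∀ C ∈ 𝒜, ∀ D ∈ ℬ, coverNumber (polarEdges A) + 2 ≤ (C ∪ D).card := by
    intro C hC D hD
    obtain ⟨hD, hD'⟩ := Finset.mem_sdiff.1 hD
    exact hcon C hC D hD hD'
  have hlowA : ∀ C ∈ 𝒜, base C ∈ 𝒜 := fun C hC => base_mem_of_lower_mem hA h𝒜 (by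
    intro C hC v hv
    by_contra hmem
    have h1 := hsep C hC _ (Finset.mem_sdiff.2 ⟨lower_mem_minCovers (h𝒜 hC) hv, hmem⟩)
    have h2 := card_union_lower_le C v
    have h3 := (mem_minCovers.1 (h𝒜 hC)).2
    omega) hC
  have hℬs : ℬ ⊆ minCovers (polarEdges A) := Finset.sdiff_subset
  have hlowB : ∀ C ∈ ℬ, base C ∈ ℬ := fun C hC => base_mem_of_lower_mem hA hℬs (by
    intro C hC v hv
    by_contra hmem
    have hmem' : lower v C ∈ 𝒜 := by
      by_contra hn
      exact hmem (Finset.mem_sdiff.2 ⟨lower_mem_minCovers (hℬs hC) hv, hn⟩)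
    have h1 := hsep _ hmem' C hC
    have h2 := card_union_lower_le C v
    have h3 := (mem_minCovers.1 (hℬs hC)).2
    rw [Finset.union_comm] at h1
    omega) hC
  have hbase : ∀ C ∈ 𝒜, ∀ D ∈ ℬ, ¬ base C ⊆ base D ∧ ¬ base D ⊆ base C := by
    intro C hC D hD
    have h1 := hsep _ (hlowA C hC) _ (hlowB D hD)
    have h2 := (mem_minCovers.1 (h𝒜 (hlowA C hC))).2
    have h3 := (mem_minCovers.1 (hℬs (hlowB D hD))).2
    constructor
    · intro hs
      rw [Finset.union_eq_right.2 hs] at h1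
      omega
    · intro hs
      rw [Finset.union_eq_left.2 hs] at h1
      omega
  have hI : monIdeal K A = 𝒜.inf (component K) ⊓ ℬ.inf (component K) := by
    rw [monIdeal_eq_inf_component hA h, ← Finset.inf_union, Finset.union_sdiff_of_subset h𝒜]
  have hd := hasDepth_of_isCohenMacaulayQuotient hA h
  have hloc : localize (monIdeal K A) =
      localize (𝒜.inf (component K)) ⊓ localize (ℬ.inf (component K)) := by
    rw [hI]
    exact IsLocalization.map_inf (varIdeal K (Finset.univ : Finset σ)).primeCompl _ _ _
  rw [hloc] at hd
  rcases hd.le_inf_or_le_inf (by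
    intro p hp
    set q := PrimeSpectrum.comap (algebraMap (MvPolynomial σ K) (LocalizedAtOrigin σ K)) p
    have hqA : 𝒜.inf (component K) ≤ q.asIdeal :=
      Ideal.map_le_iff_le_comap.1 (le_sup_left.trans hp)
    have hqB : ℬ.inf (component K) ≤ q.asIdeal :=
      Ideal.map_le_iff_le_comap.1 (le_sup_right.trans hp)
    obtain ⟨C, hC, hCq⟩ := (Ideal.IsPrime.inf_le' q.2).1 hqA
    obtain ⟨D, hD, hDq⟩ := (Ideal.IsPrime.inf_le' q.2).1 hqB
    have h1 := hsep _ (hlowA C hC) _ (hlowB D hD)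
    have hcard : (base C ∪ base D).card ≤ ((C ∪ D).image Sigma.fst).card := by
      have : base C ∪ base D = ((C ∪ D).image Sigma.fst).image fun v => ⟨v, 0⟩ := by
        rw [base, base, ← Finset.image_union, Finset.image_image]
        rfl
      rw [this]
      exact Finset.card_image_le
    have h2 := coheight_add_card_le (p := q) (Z := (C ∪ D).image Sigma.fst) (by
      intro v hv
      obtain ⟨x, hx, rfl⟩ := Finset.mem_image.1 hv
      rcases Finset.mem_union.1 hx with hx | hx
      · exact X_mem_of_component_le hCq hx
      · exact X_mem_of_component_le hDq hx)
    have h3 := (add_le_add_left (coheight_le_coheight_comap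
      (varIdeal K (Finset.univ : Finset σ)).primeCompl p) _).trans h2
    obtain ⟨m, hm⟩ := ENat.ne_top_iff_exists.1 (ne_top_of_le_ne_top (ENat.natCast_ne_top _)
      (le_self_add.trans h3))
    rw [← hm] at h3 ⊢
    have h4 : m + ((C ∪ D).image Sigma.fst).card ≤ Fintype.card σ := by exact_mod_cast h3
    exact_mod_cast (by omega : m + 2 ≤ Fintype.card σ - coverNumber (polarEdges A))) with hle | hle
  · obtain ⟨C, hC, D, hD, hCD⟩ := exists_base_subset_base hℬne (hle.trans inf_le_right)
    exact (hbase C hC D hD).1 hCD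
  · obtain ⟨D, hD, C, hC, hDC⟩ := exists_base_subset_base hne (hle.trans inf_le_left)
    exact (hbase C hC D hD).2 hDC

end CohenMacaulay
end TaylorBound

theorem theorem5p1 {K : Type*} [Field K] (n : ℕ) (I : Ideal (MvPolynomial (Fin n) K))
    (hI : TaylorBound.IsQuadraticMonomialIdeal I) :
    ∃ c e : ℕ, I.height = c ∧ TaylorBound.HasMultiplicity I e ∧
      (e : ℚ) ≤ (∏ i ∈ Finset.Icc 1 c, (TaylorBound.taylorMaxShift I i : ℚ)) / c.factorial ∧
      (TaylorBound.IsCohenMacaulayQuotient I →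
        (∏ i ∈ Finset.Icc 1 c, (TaylorBound.taylorMinShift I i : ℚ)) / c.factorial ≤ (e : ℚ)) := by
  obtain ⟨A', hA', hIA⟩ := hI
  have hfin : A'.Finite := by
    refine (Finset.finite_toSet (Finset.univ.finsuppAntidiag 2)).subset fun a ha => ?_
    rw [Finset.mem_coe, Finset.mem_finsuppAntidiag]
    exact ⟨by rw [← Finsupp.degree_eq_sum, hA' a ha], Finset.subset_univ _⟩
  obtain ⟨A, rfl⟩ := hfin.exists_finset_coe
  obtain rfl : I = TaylorBound.monIdeal K A := hIA
  have hA : ∀ a ∈ A, a.degree = 2 := hA'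
  have h2 := TaylorBound.card_of_mem_polarEdges hA
  obtain ⟨Z, hZ, hZc⟩ := TaylorBound.exists_isVarCover hA
  refine ⟨TaylorBound.coverNumber (TaylorBound.polarEdges A),
    (TaylorBound.minCovers (TaylorBound.polarEdges A)).card,
    TaylorBound.height_monIdeal (fun Z hZ => TaylorBound.coverNumber_le_card_of_isVarCover hZ) hZ
      hZc, TaylorBound.hasMultiplicity_monIdeal hA, ?_, fun hCM => ?_⟩
  · rw [le_div_iff₀ (by positivity)]
    have h := (TaylorBound.card_minCovers_mul_factorial_le h2).trans (Finset.prod_le_prod'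
      fun i _ => TaylorBound.maxSpan_le_taylorMaxShift (K := K) hA i)
    exact_mod_cast h
  · rw [div_le_iff₀ (by positivity)]
    have h := TaylorBound.prod_le_card_minCovers_mul_factorial h2
      (TaylorBound.connectedInCodimOne_minCovers hA hCM)
      (TaylorBound.exists_minCover_notMem hA hCM)
      (TaylorBound.taylorMinShift (TaylorBound.monIdeal K A))
      fun T hT => TaylorBound.taylorMinShift_le hA hT
    exact_mod_cast h
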